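/- Let $\Gamma\subset PSL(3,\mathbb C)=SL(3,\mathbb C)/\{\text{cube roots of unity}\}$ be a discrete subgroup, acting on the complex projective plane $\mathbb P^2_{\mathbb C}$ with its Fubini–Study metric. For any subgroup $G\subset PSL(3,\mathbb C)$ and any $K\subset\mathbb P^2_{\mathbb C}$, a cluster point of the family $\{\gamma(K)\}_{\gamma\in G}$ is a limit of a sequence $\gamma_m(k_m)$ with $k_m\in K$ and pairwise distinct $\gamma_m\in G$. Let $L_0(G)$ be the closure of the set of points whose isotropy group in $G$ is infinite; let $L_1(G)$ be the closure of the set of cluster points of the orbits $Gz$ (that is, $K=\{z\}$), $z\in\mathbb P^2_{\mathbb C}\setminus L_0(G)$; and let $L_2(G)$ be the closure of the set of cluster points of the families $\{\gamma(K)\}_{\gamma\in G}$, where $K$ runs over the compact subsets of $\mathbb P^2_{\mathbb C}\setminus(L_0(G)\cup L_1(G))$. The Kulkarni limit set is $\Lambda(G)=L_0(G)\cup L_1(G)\cup L_2(G)$ and the Kulkarni discontinuity region is $\Omega(G)=\mathbb P^2_{\mathbb C}\setminus\Lambda(G)$. Write $\Lambda(\gamma)=\Lambda(\langle\gamma\rangle)$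 and $$C(\Gamma)=\overline{\bigcup_{\gamma\in\Gamma}\Lambda(\gamma)} .$$ The equicontinuity set $\mathrm{Eq}(\Gamma)$ is the set of points having an open neighbourhood $U$ such that every sequence of pairwise distinct elements of $\Gamma$ has a subsequence which converges uniformly on compact subsets of $U$. Suppose that each of the sets $\Lambda(\Gamma)$ and $C(\Gamma)$ contains three distinct complex lines in general position, i.e. without a common point. Then: 1. $\Lambda(\Gamma)=C(\Gamma)$, and $\Lambda(\Gamma)$ is a union of complex lines; 2. $\Omega(\Gamma)=\mathrm{Eq}(\Gamma)$; 3. if moreover no point of $\mathbb P^2_{\mathbb C}$ is fixed by all of $\Gamma$, then $\Omega(\Gamma)$ is the largest open set on which $\Gamma$ acts properly and discontinuously. That is, $\Omega(\Gamma)$ is itself an open $\Gamma$-invariant set on which $\Gamma$ acts properly and discontinuously, and it contains every open $\Gamma$-invariant set $U$ on which $\Gamma$ acts properly and discontinuously. Here $\Gamma$ acts properly and discontinuously on $U$ if, for every compact $K\subset U$, the set $\{\gamma\in\Gamma:\gamma(K)\cap K\neq\varnothing\}$ is finite. -/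

import Mathlib

open Set Filter Topology
open scoped MatrixGroups LinearAlgebra.Projectivization

namespace KulkarniPlane

/-- The complex projective plane. -/
abbrev P2 : Type := ℙ ℂ (Fin 3 → ℂ)

/-- The quotient topology from the nonzero vectors of `ℂ³`. -/
noncomputable instance instTopologicalSpaceP2 : TopologicalSpace P2 :=
  TopologicalSpace.coinduced
    (Projectivization.mk' ℂ : {v : Fin 3 → ℂ // v ≠ 0} → P2) inferInstance

/-- The angle `arccos (|⟨v, w⟩| / (‖v‖ ‖w‖))` between two vectors of `ℂ³`
(Hermitian inner product and Euclidean norm), taken up to complex phases. -/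
noncomputable def hermitianAngle (v w : Fin 3 → ℂ) : ℝ :=
  Real.arccos (‖inner ℂ (WithLp.toLp 2 v : EuclideanSpace ℂ (Fin 3)) (WithLp.toLp 2 w)‖ /
    (‖(WithLp.toLp 2 v : EuclideanSpace ℂ (Fin 3))‖ *
      ‖(WithLp.toLp 2 w : EuclideanSpace ℂ (Fin 3))‖))

/-- The Fubini–Study distance on the complex projective plane. -/
noncomputable def fubiniStudyDist (p q : P2) : ℝ :=
  hermitianAngle p.rep q.rep

theorem hermitianAngle_smul (a b : ℂ) (ha : a ≠ 0) (hb : b ≠ 0) (v w : Fin 3 → ℂ) :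
    hermitianAngle (a • v) (b • w) = hermitianAngle v w := by
  unfold hermitianAngle
  rw [WithLp.toLp_smul, WithLp.toLp_smul, inner_smul_left, inner_smul_right, norm_mul, norm_mul,
    norm_smul, norm_smul, RCLike.norm_conj]
  have h : ‖a‖ * ‖b‖ ≠ 0 := mul_ne_zero (norm_ne_zero_iff.2 ha) (norm_ne_zero_iff.2 hb)
  rw [← mul_assoc, mul_mul_mul_comm ‖a‖ _ ‖b‖, mul_div_mul_left _ _ h]

/-- The distance does not depend on the choice of homogeneous coordinates. -/
theorem fubiniStudyDist_mk (v w : Fin 3 → ℂ) (hv : v ≠ 0) (hw : w ≠ 0) :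
    fubiniStudyDist (Projectivization.mk ℂ v hv) (Projectivization.mk ℂ w hw) =
      hermitianAngle v w := by
  obtain ⟨a, ha⟩ := Projectivization.exists_smul_eq_mk_rep ℂ v hv
  obtain ⟨b, hb⟩ := Projectivization.exists_smul_eq_mk_rep ℂ w hw
  unfold fubiniStudyDist
  rw [← ha, ← hb]
  exact hermitianAngle_smul _ _ a.ne_zero b.ne_zero v w

/-- Complex lines: projectivizations of two-dimensional subspaces of `ℂ³`. -/
def IsComplexLine (l : Set P2) : Prop :=
  ∃ W : Submodule ℂ (Fin 3 → ℂ), Module.finrank ℂ W = 2 ∧ l = {p : P2 | p.submodule ≤ W}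

/-- `A` contains (at least) three complex lines in general position, that is, three pairwise
distinct complex lines without a common point. -/
def ContainsThreeLinesInGeneralPosition (A : Set P2) : Prop :=
  ∃ l₁ l₂ l₃ : Set P2, IsComplexLine l₁ ∧ IsComplexLine l₂ ∧ IsComplexLine l₃ ∧
    l₁ ≠ l₂ ∧ l₁ ≠ l₃ ∧ l₂ ≠ l₃ ∧ l₁ ∩ l₂ ∩ l₃ = ∅ ∧ l₁ ⊆ A ∧ l₂ ⊆ A ∧ l₃ ⊆ A

/-- `A` is a union of complex lines. -/
def IsUnionOfComplexLines (A : Set P2) : Prop :=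
  ∃ L : Set (Set P2), (∀ l ∈ L, IsComplexLine l) ∧ A = ⋃₀ L

/-- Cluster points of the family of sets `γ(K)`, `γ ∈ Γ`: the limits of `γ_m(k_m)` for sequences
of points `k_m` of `K` and of pairwise distinct elements `γ_m` of `Γ`. -/
def clusterPoints (Γ : Subgroup PSL(3, ℂ)) (K : Set P2) : Set P2 :=
  {q | ∃ (k : ℕ → P2) (γ : ℕ → PSL(3, ℂ)), (∀ m, k m ∈ K) ∧ (∀ m, γ m ∈ Γ) ∧
    Function.Injective γ ∧ Tendsto (fun m => γ m • k m) atTop (𝓝 q)}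

/-- `L₀(Γ)`: the closure of the set of points with infinite isotropy group. -/
def L0 (Γ : Subgroup PSL(3, ℂ)) : Set P2 :=
  closure {z | {γ : PSL(3, ℂ) | γ ∈ Γ ∧ γ • z = z}.Infinite}

/-- `L₁(Γ)`: the closure of the set of cluster points of orbits of points outside `L₀(Γ)`. -/
def L1 (Γ : Subgroup PSL(3, ℂ)) : Set P2 :=
  closure (⋃ z ∈ (L0 Γ)ᶜ, clusterPoints Γ {z})

/-- `L₂(Γ)`: the closure of the set of cluster points of the families `γ(K)`, for `K` compact and
disjoint from `L₀(Γ) ∪ L₁(Γ)`. -/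
def L2 (Γ : Subgroup PSL(3, ℂ)) : Set P2 :=
  closure {q | ∃ K : Set P2, IsCompact K ∧ K ⊆ (L0 Γ ∪ L1 Γ)ᶜ ∧ q ∈ clusterPoints Γ K}

/-- Kulkarni's limit set `Λ(Γ)`. -/
def limitSet (Γ : Subgroup PSL(3, ℂ)) : Set P2 :=
  L0 Γ ∪ L1 Γ ∪ L2 Γ

/-- Kulkarni's discontinuity region `Ω(Γ)`. -/
def discontinuityRegion (Γ : Subgroup PSL(3, ℂ)) : Set P2 :=
  (limitSet Γ)ᶜ

/-- `C(Γ)`: the closure of the union of the limit sets of the cyclic groups generated by the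
elements of `Γ`. -/
def cyclicLimitSet (Γ : Subgroup PSL(3, ℂ)) : Set P2 :=
  closure (⋃ γ ∈ Γ, limitSet (Subgroup.zpowers γ))

/-- `f n` converges to `g`, uniformly on every compact subset of `U`. -/
def ConvergesUniformlyOnCompacts (f : ℕ → P2 → P2) (g : P2 → P2) (U : Set P2) : Prop :=
  ∀ K : Set P2, IsCompact K → K ⊆ U → ∀ ε : ℝ, 0 < ε →
    ∃ N : ℕ, ∀ n, N ≤ n → ∀ x ∈ K, fubiniStudyDist (f n x) (g x) < ε

/-- `F` is a normal family on `U`: every sequence of pairwise distinct elements of `F` has a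
subsequence that converges uniformly on compact subsets of `U`. -/
def IsNormalFamilyOn (F : Set PSL(3, ℂ)) (U : Set P2) : Prop :=
  ∀ γ : ℕ → PSL(3, ℂ), (∀ n, γ n ∈ F) → Function.Injective γ →
    ∃ φ : ℕ → ℕ, StrictMono φ ∧ ∃ g : P2 → P2,
      ConvergesUniformlyOnCompacts (fun n x => γ (φ n) • x) g U

/-- The equicontinuity set `Eq(F)`. -/
def equicontinuitySet (F : Set PSL(3, ℂ)) : Set P2 :=
  {z | ∃ U : Set P2, IsOpen U ∧ z ∈ U ∧ IsNormalFamilyOn F U}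

/-- `Γ` acts properly and discontinuously on `U`: `U` is `Γ`-invariant and, for every compact
subset `K` of `U`, only finitely many `γ ∈ Γ` satisfy `γ(K) ∩ K ≠ ∅`. -/
def ActsProperlyDiscontinuouslyOn (Γ : Subgroup PSL(3, ℂ)) (U : Set P2) : Prop :=
  (∀ γ ∈ Γ, ∀ x ∈ U, γ • x ∈ U) ∧
    ∀ K : Set P2, IsCompact K → K ⊆ U →
      {γ : PSL(3, ℂ) | γ ∈ Γ ∧ (((fun x : P2 => γ • x) '' K) ∩ K).Nonempty}.Finite

end KulkarniPlane

/-!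
The proof rests on the limits of sequences of pairwise distinct elements `γ n` of the discrete group
`Γ`. Lifted to `SL(3, ℂ)` and rescaled, a subsequence converges to a nonzero matrix `M`, and the
inverses converge likewise to a nonzero `M'` (`Degenerates`, `exists_subseq_degenerates`).
Discreteness makes the scaling factors tend to zero, hence `M * M' = M' * M = 0`. Off the kernel of
`M` the transformations converge locally uniformly to `M`, and near a kernel point no subsequence
does (`isNormalFamilyOn_of_forall_mulVec_ne_zero`, `mulVec_ne_zero_of_mem_equicontinuitySet`). So
`Eq(Γ)` is the complement of the closure of the union of all these kernels.

Since `M' * M = 0`, the group acts properly discontinuously on `Eq(Γ)`, and one checks directly that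
none of `L₀`, `L₁`, `L₂` meets `Eq(Γ)`; thus `Eq(Γ) ⊆ Ω(Γ)` for every discrete group, in particular
for the cyclic subgroups, and therefore `C(Γ) ⊆ Eq(Γ)ᶜ`. Conversely, let `F` be a closed invariant
set which contains three lines in general position. One of them, of equation `φ = 0`, does not contain
the image of `M`; the lines `γ n⁻¹ {φ = 0}` lie in `F` and converge to the line `φ M = 0`, which
contains the kernel of `M`. Hence `F` contains a line through each kernel point, and `Fᶜ ⊆ Eq(Γ)`
(`compl_subset_equicontinuitySet`). Applied to `Λ(Γ)` and to `C(Γ)` this gives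
`Λ(Γ) = C(Γ) = Eq(Γ)ᶜ`; that this set is a union of lines follows since limits of lines are lines.

For the maximality, let `U` be open, invariant, with a properly discontinuous action. By the above it
is enough that `Uᶜ` contains three lines in general position. A dynamical argument
(`ActsProperlyDiscontinuouslyOn.lineOf_subset_compl`) shows that `Uᶜ` contains a line. If it does not
contain three in general position, and `Γ` fixes no point, then it contains exactly one line, which
is invariant, and which is the kernel of `M` or of `M'` for every degenerating sequence
(`ActsProperlyDiscontinuouslyOn.mulVec_eq_zero_or`). On the other hand `Eq(Γ)ᶜ` is not contained in
this line `{χ = 0}`, so that some `M` kills a point off the line, and `M'` has rank one with kernel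
the line. If the image point of `M'` is off the line, then `Γ` contains a contraction `g` of the
affine plane `{χ ≠ 0}` with fixed point `f`; if `h f ≠ f`, both limits of the conjugates
`g ^ k * h * (g ^ k)⁻¹` kill `f`, a contradiction, so that `f` is fixed by `Γ`. If the image point is
on the line, then a point of the line is fixed, since otherwise the conjugates `(γ n)⁻¹ * h * γ n`,
for a suitable `h`, have two limits neither of which vanishes on the line.
-/

namespace KulkarniPlane

open Matrix

/-! ### Homogeneous coordinates and the topology of the projective plane -/

/-- The point of the projective plane with homogeneous coordinates `v`. The zero vector, which has
no meaning as homogeneous coordinates, is sent to an arbitrary point. -/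
noncomputable def pt (v : Fin 3 → ℂ) : P2 :=
  open Classical in
  if h : v = 0 then Projectivization.mk ℂ ![1, 0, 0] (by simp) else Projectivization.mk ℂ v h

theorem pt_of_ne {v : Fin 3 → ℂ} (h : v ≠ 0) : pt v = Projectivization.mk ℂ v h := by
  simp [pt, h]

theorem pt_rep (p : P2) : pt p.rep = p := by
  rw [pt_of_ne p.rep_nonzero, Projectivization.mk_rep]

theorem exists_pt (p : P2) : ∃ v : Fin 3 → ℂ, v ≠ 0 ∧ pt v = p :=
  ⟨p.rep, p.rep_nonzero, pt_rep p⟩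

theorem pt_eq_pt_iff {v w : Fin 3 → ℂ} (hv : v ≠ 0) (hw : w ≠ 0) :
    pt v = pt w ↔ ∃ a : ℂ, a • w = v := by
  rw [pt_of_ne hv, pt_of_ne hw, Projectivization.mk_eq_mk_iff']

theorem pt_smul {a : ℂ} (ha : a ≠ 0) {v : Fin 3 → ℂ} (hv : v ≠ 0) : pt (a • v) = pt v :=
  (pt_eq_pt_iff (smul_ne_zero ha hv) hv).2 ⟨a, rfl⟩

/-- Every point has homogeneous coordinates of norm one. -/
theorem exists_pt_norm_one (p : P2) : ∃ v : Fin 3 → ℂ, ‖v‖ = 1 ∧ pt v = p := by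
  obtain ⟨v, hv, rfl⟩ := exists_pt p
  have h : (‖v‖ : ℂ)⁻¹ ≠ 0 := by simpa using hv
  refine ⟨(‖v‖ : ℂ)⁻¹ • v, ?_, pt_smul h hv⟩
  rw [norm_smul, norm_inv, Complex.norm_real, norm_norm, inv_mul_cancel₀ (norm_ne_zero_iff.2 hv)]

theorem ne_zero_of_norm_one {v : Fin 3 → ℂ} (h : ‖v‖ = 1) : v ≠ 0 := by
  rintro rfl
  simp at h

theorem isOpenQuotientMap_mk :
    IsOpenQuotientMap (Projectivization.mk' ℂ : {v : Fin 3 → ℂ // v ≠ 0} → P2) := by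
  refine ⟨fun p => ⟨⟨p.rep, p.rep_nonzero⟩, p.mk_rep⟩, continuous_coinduced_rng, fun U hU => ?_⟩
  rw [isOpen_coinduced]
  have key : (Projectivization.mk' ℂ : {v : Fin 3 → ℂ // v ≠ 0} → P2) ⁻¹'
      (Projectivization.mk' ℂ '' U) =
      ⋃ a : ℂˣ, (fun v : {v : Fin 3 → ℂ // v ≠ 0} =>
        (⟨a • v.1, smul_ne_zero a.ne_zero v.2⟩ : {v : Fin 3 → ℂ // v ≠ 0})) ⁻¹' U := by
    ext v
    simp only [mem_preimage, mem_image, mem_iUnion]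
    constructor
    · rintro ⟨w, hw, h⟩
      obtain ⟨a, ha⟩ := (Projectivization.mk_eq_mk_iff ℂ w.1 v.1 w.2 v.2).1 h
      refine ⟨a, ?_⟩
      convert hw
    · rintro ⟨a, ha⟩
      exact ⟨_, ha, (Projectivization.mk_eq_mk_iff ℂ _ _ _ _).2 ⟨a, rfl⟩⟩
  rw [key]
  refine isOpen_iUnion fun a => hU.preimage ?_
  exact Continuous.subtype_mk (continuous_subtype_val.const_smul a) _

theorem continuousAt_pt {v : Fin 3 → ℂ} (hv : v ≠ 0) : ContinuousAt pt v := by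
  have ho : IsOpen {w : Fin 3 → ℂ | w ≠ 0} := isOpen_ne
  have hc : ContinuousOn pt {w : Fin 3 → ℂ | w ≠ 0} := by
    rw [continuousOn_iff_continuous_domRestrict]
    exact isOpenQuotientMap_mk.continuous.congr fun w => (pt_of_ne w.2).symm
  exact hc.continuousAt (ho.mem_nhds hv)

theorem tendsto_pt {ι : Type*} {l : Filter ι} {x : ι → Fin 3 → ℂ} {v : Fin 3 → ℂ} (hv : v ≠ 0)
    (h : Tendsto x l (𝓝 v)) : Tendsto (fun i => pt (x i)) l (𝓝 (pt v)) :=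
  (continuousAt_pt hv).tendsto.comp h

/-- The image of a neighbourhood of `v` is a neighbourhood of the point `pt v`. -/
theorem image_pt_mem_nhds {v : Fin 3 → ℂ} (hv : v ≠ 0) {s : Set (Fin 3 → ℂ)} (hs : s ∈ 𝓝 v) :
    pt '' (s \ {0}) ∈ 𝓝 (pt v) := by
  rw [pt_of_ne hv]
  have h := isOpenQuotientMap_mk.map_nhds_eq ⟨v, hv⟩
  have h' : (Projectivization.mk' ℂ : {v : Fin 3 → ℂ // v ≠ 0} → P2) ⟨v, hv⟩ =
    Projectivization.mk ℂ v hv := rfl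
  rw [← h', ← h, mem_map]
  filter_upwards [continuous_subtype_val.continuousAt.preimage_mem_nhds hs] with w hw
  exact ⟨w.1, ⟨hw, w.2⟩, pt_of_ne w.2⟩

/-- A function on the plane is continuous as soon as it is continuous in homogeneous
coordinates. -/
theorem continuousAt_of_comp_pt {Y : Type*} [TopologicalSpace Y] {f : P2 → Y} {v : Fin 3 → ℂ}
    (hv : v ≠ 0) (h : ContinuousAt (fun w => f (pt w)) v) : ContinuousAt f (pt v) := by
  rw [pt_of_ne hv]
  refine (isOpenQuotientMap_mk.continuousAt_comp_iff (g := f) (x := ⟨v, hv⟩)).1 ?_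
  have : f ∘ (Projectivization.mk' ℂ : {v : Fin 3 → ℂ // v ≠ 0} → P2) =
      (fun w => f (pt w)) ∘ Subtype.val := by
    ext w
    exact congrArg f (pt_of_ne w.2).symm
  rw [this]
  exact ContinuousAt.comp (f := Subtype.val) (x := (⟨v, hv⟩ : {v : Fin 3 → ℂ // v ≠ 0})) h
    continuous_subtype_val.continuousAt

/-- A convergent sequence of points lifts to a convergent sequence of homogeneous coordinates, with
prescribed limit. -/
theorem exists_lift_tendsto {x : ℕ → P2} {v : Fin 3 → ℂ} (hv : v ≠ 0)
    (h : Tendsto x atTop (𝓝 (pt v))) :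
    ∃ y : ℕ → Fin 3 → ℂ, (∀ n, y n ≠ 0) ∧ (∀ n, pt (y n) = x n) ∧ Tendsto y atTop (𝓝 v) := by
  obtain ⟨i, hi⟩ : ∃ i, v i ≠ 0 := by
    by_contra hc
    push Not at hc
    exact hv (funext hc)
  -- the section of the chart `vᵢ ≠ 0` whose `i`-th coordinate is `v i`
  let s : P2 → Fin 3 → ℂ := fun p => (v i / p.rep i) • p.rep
  have hs : ∀ w : Fin 3 → ℂ, w i ≠ 0 → s (pt w) = (v i / w i) • w := by
    intro w hw
    have hw0 : w ≠ 0 := by rintro rfl; simp at hw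
    obtain ⟨a, ha⟩ := (pt_eq_pt_iff (pt w).rep_nonzero hw0).1 (pt_rep (pt w))
    have ha0 : a ≠ 0 := by
      rintro rfl
      exact (pt w).rep_nonzero (by rw [← ha, zero_smul])
    simp only [s, ← ha]
    rw [smul_smul]
    congr 1
    simp only [Pi.smul_apply, smul_eq_mul]
    field_simp
  have hsc : ContinuousAt s (pt v) := by
    apply continuousAt_of_comp_pt hv
    have hev : ∀ᶠ w : Fin 3 → ℂ in 𝓝 v, w i ≠ 0 :=
      (continuous_apply i).continuousAt.eventually_ne hi
    have : ContinuousAt (fun w : Fin 3 → ℂ => (v i / w i) • w) v :=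
      (continuousAt_const.div (continuous_apply i).continuousAt hi).smul continuousAt_id
    exact this.congr (hev.mono fun w hw => (hs w hw).symm)
  have hlim : Tendsto (fun n => s (x n)) atTop (𝓝 v) := by
    have := hsc.tendsto.comp h
    rwa [hs v hi, div_self hi, one_smul] at this
  have hpt : ∀ p, s p ≠ 0 → pt (s p) = p := by
    intro p hp
    have : v i / p.rep i ≠ 0 := by
      intro h0
      simp [s, h0] at hp
    simp only [s]
    rw [pt_smul this p.rep_nonzero, pt_rep]
  classical
  refine ⟨fun n => if s (x n) = 0 then (x n).rep else s (x n), fun n => ?_, fun n => ?_, ?_⟩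
  · by_cases hn : s (x n) = 0
    · simp [hn, (x n).rep_nonzero]
    · simp [hn]
  · by_cases hn : s (x n) = 0
    · simpa [hn] using pt_rep (x n)
    · simpa [hn] using hpt _ hn
  · refine hlim.congr' ?_
    filter_upwards [hlim.eventually_ne hv] with n hn
    simp [hn]

/-- Every sequence of points has a subsequence along which suitable homogeneous coordinates of norm
one converge. -/
theorem exists_subseq_lift (x : ℕ → P2) :
    ∃ (φ : ℕ → ℕ) (y : ℕ → Fin 3 → ℂ) (v : Fin 3 → ℂ), StrictMono φ ∧ v ≠ 0 ∧
      (∀ n, y n ≠ 0) ∧ (∀ n, pt (y n) = x (φ n)) ∧ Tendsto y atTop (𝓝 v) := by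
  choose y hy hyx using fun n => exists_pt_norm_one (x n)
  obtain ⟨v, hv, φ, hφ, hlim⟩ := (isCompact_sphere (0 : Fin 3 → ℂ) 1).tendsto_subseq
    (x := y) (fun n => by simp [hy n])
  refine ⟨φ, y ∘ φ, v, hφ, ne_zero_of_norm_one (by simpa using hv),
    fun n => ne_zero_of_norm_one (hy _), fun n => hyx _, hlim⟩

instance : CompactSpace P2 := by
  refine ⟨?_⟩
  have h : (univ : Set P2) = pt '' Metric.sphere (0 : Fin 3 → ℂ) 1 := by
    ext p
    obtain ⟨v, hv, rfl⟩ := exists_pt_norm_one p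
    exact ⟨fun _ => ⟨v, by simp [hv], rfl⟩, fun _ => trivial⟩
  rw [h]
  refine (isCompact_sphere (0 : Fin 3 → ℂ) 1).image_of_continuousOn fun v hv => ?_
  exact (continuousAt_pt (ne_zero_of_norm_one (by simpa using hv))).continuousWithinAt

/-! ### The Fubini–Study distance -/

theorem fubiniStudyDist_pt {v w : Fin 3 → ℂ} (hv : v ≠ 0) (hw : w ≠ 0) :
    fubiniStudyDist (pt v) (pt w) = hermitianAngle v w := by
  rw [pt_of_ne hv, pt_of_ne hw, fubiniStudyDist_mk]

theorem continuousAt_hermitianAngle {v w : Fin 3 → ℂ} (hv : v ≠ 0) (hw : w ≠ 0) :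
    ContinuousAt (fun p : (Fin 3 → ℂ) × (Fin 3 → ℂ) => hermitianAngle p.1 p.2) (v, w) := by
  unfold hermitianAngle
  have h1 : Continuous (fun p : (Fin 3 → ℂ) × (Fin 3 → ℂ) =>
      (WithLp.toLp 2 p.1 : EuclideanSpace ℂ (Fin 3))) :=
    (PiLp.continuous_toLp 2 _).comp continuous_fst
  have h2 : Continuous (fun p : (Fin 3 → ℂ) × (Fin 3 → ℂ) =>
      (WithLp.toLp 2 p.2 : EuclideanSpace ℂ (Fin 3))) :=
    (PiLp.continuous_toLp 2 _).comp continuous_snd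
  refine Real.continuous_arccos.continuousAt.comp (ContinuousAt.div ?_ ?_ ?_)
  · exact (h1.inner h2).norm.continuousAt
  · exact (h1.norm.mul h2.norm).continuousAt
  · refine mul_ne_zero (norm_ne_zero_iff.2 ?_) (norm_ne_zero_iff.2 ?_)
    · simpa using hv
    · simpa using hw

theorem hermitianAngle_self {v : Fin 3 → ℂ} (hv : v ≠ 0) : hermitianAngle v v = 0 := by
  unfold hermitianAngle
  have h : ‖(WithLp.toLp 2 v : EuclideanSpace ℂ (Fin 3))‖ ≠ 0 := norm_ne_zero_iff.2 (by simpa)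
  rw [Real.arccos_eq_zero, inner_self_eq_norm_sq_to_K, norm_pow, RCLike.norm_ofReal, abs_norm,
    sq, div_self (mul_ne_zero h h)]

theorem fubiniStudyDist_self (p : P2) : fubiniStudyDist p p = 0 :=
  hermitianAngle_self p.rep_nonzero

theorem fubiniStudyDist_nonneg (p q : P2) : 0 ≤ fubiniStudyDist p q :=
  Real.arccos_nonneg _

theorem eq_of_fubiniStudyDist_le_zero {p q : P2} (h : fubiniStudyDist p q ≤ 0) : p = q := by
  obtain ⟨v, hv, rfl⟩ := exists_pt p
  obtain ⟨w, hw, rfl⟩ := exists_pt q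
  rw [fubiniStudyDist_pt hv hw] at h
  replace h := le_antisymm h (Real.arccos_nonneg _)
  have hv' : (WithLp.toLp 2 v : EuclideanSpace ℂ (Fin 3)) ≠ 0 := by simpa
  have hw' : (WithLp.toLp 2 w : EuclideanSpace ℂ (Fin 3)) ≠ 0 := by simpa
  rw [hermitianAngle, Real.arccos_eq_zero, one_le_div (by positivity)] at h
  obtain ⟨r, hr, h⟩ := (norm_inner_eq_norm_iff hv' hw').1 (le_antisymm (norm_inner_le_norm _ _) h)
  rw [eq_comm, pt_eq_pt_iff hw hv]
  refine ⟨r, ?_⟩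
  simpa using (congrArg WithLp.ofLp h).symm

theorem continuous_fubiniStudyDist_right (q : P2) : Continuous fun p => fubiniStudyDist p q := by
  rw [continuous_iff_continuousAt]
  intro p
  obtain ⟨v, hv, rfl⟩ := exists_pt p
  obtain ⟨w, hw, rfl⟩ := exists_pt q
  apply continuousAt_of_comp_pt hv
  have h : ContinuousAt (fun u => hermitianAngle u w) v :=
    ContinuousAt.comp (f := fun u => (u, w)) (continuousAt_hermitianAngle hv hw)
      (by fun_prop)
  refine h.congr ?_
  filter_upwards [isOpen_ne.mem_nhds hv] with u hu
  exact (fubiniStudyDist_pt hu hw).symm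

instance : T2Space P2 := by
  refine ⟨fun p q hpq => ?_⟩
  have h : fubiniStudyDist p q ≠ fubiniStudyDist q q := by
    rw [fubiniStudyDist_self]
    exact fun h => hpq (eq_of_fubiniStudyDist_le_zero h.le)
  exact separated_by_continuous (continuous_fubiniStudyDist_right q) h

theorem tendsto_of_tendsto_fubiniStudyDist {x : ℕ → P2} {q : P2}
    (h : Tendsto (fun n => fubiniStudyDist (x n) q) atTop (𝓝 0)) : Tendsto x atTop (𝓝 q) := by
  rw [(nhds_basis_opens q).tendsto_right_iff]
  rintro O ⟨hqO, hO⟩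
  by_contra hc
  obtain ⟨ψ, hψ, hψO⟩ := extraction_of_frequently_atTop (not_eventually.1 hc)
  obtain ⟨φ, y, v, hφ, hv, -, hy, hlim⟩ := exists_subseq_lift (x ∘ ψ)
  have h1 : Tendsto (fun n => x (ψ (φ n))) atTop (𝓝 (pt v)) :=
    (tendsto_pt hv hlim).congr hy
  have h2 : Tendsto (fun n => fubiniStudyDist (x (ψ (φ n))) q) atTop (𝓝 0) :=
    h.comp (hψ.comp hφ).tendsto_atTop
  have h3 := tendsto_nhds_unique
    (((continuous_fubiniStudyDist_right q).tendsto (pt v)).comp h1) h2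
  rw [← eq_of_fubiniStudyDist_le_zero h3.le] at hqO
  obtain ⟨n, hn⟩ := (h1.eventually (hO.mem_nhds hqO)).exists
  exact hψO _ hn

/-! ### Complex lines and the action on points -/

/-- The complex line of equation `φ ⬝ᵥ v = 0`, for a nonzero covector `φ`. -/
def lineOf (φ : Fin 3 → ℂ) : Set P2 := {p | φ ⬝ᵥ p.rep = 0}

theorem pt_mem_lineOf {φ v : Fin 3 → ℂ} (hv : v ≠ 0) : pt v ∈ lineOf φ ↔ φ ⬝ᵥ v = 0 := by
  obtain ⟨a, ha⟩ := (pt_eq_pt_iff hv (pt v).rep_nonzero).1 (pt_rep (pt v)).symm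
  have ha0 : a ≠ 0 := by
    rintro rfl
    exact hv (by rw [← ha, zero_smul])
  rw [← ha, dotProduct_smul, ha]
  simp [lineOf, ha0]

theorem isClosed_lineOf (φ : Fin 3 → ℂ) : IsClosed (lineOf φ) := by
  rw [← isOpenQuotientMap_mk.isQuotientMap.isClosed_preimage]
  have h : (Projectivization.mk' ℂ : {v : Fin 3 → ℂ // v ≠ 0} → P2) ⁻¹' lineOf φ =
      {v | φ ⬝ᵥ v.1 = 0} := by
    ext v
    have := pt_mem_lineOf (φ := φ) v.2
    rw [pt_of_ne v.2] at this
    exact this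
  rw [h]
  exact isClosed_eq (continuous_const.dotProduct continuous_subtype_val) continuous_const

theorem lineOf_smul {c : ℂ} (hc : c ≠ 0) (φ : Fin 3 → ℂ) : lineOf (c • φ) = lineOf φ := by
  ext p
  simp [lineOf, hc]

theorem exists_smul_eq_of_lineOf_subset {φ ψ : Fin 3 → ℂ} (hφ : φ ≠ 0)
    (h : lineOf φ ⊆ lineOf ψ) : ∃ c : ℂ, ψ = c • φ := by
  obtain ⟨i, hi⟩ : ∃ i, φ i ≠ 0 := by
    by_contra hc
    push Not at hc
    exact hφ (funext hc)
  have key : ∀ v : Fin 3 → ℂ, φ ⬝ᵥ v = 0 → ψ ⬝ᵥ v = 0 := by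
    intro v hv
    by_cases h0 : v = 0
    · simp [h0]
    · exact (pt_mem_lineOf h0).1 (h ((pt_mem_lineOf h0).2 hv))
  refine ⟨ψ i / φ i, funext fun j => ?_⟩
  have h1 := key (φ i • Pi.single j 1 - φ j • Pi.single i 1) (by
    simp [dotProduct_sub, mul_comm])
  simp only [dotProduct_sub, dotProduct_smul, dotProduct_single, smul_eq_mul, mul_one] at h1
  simp only [Pi.smul_apply, smul_eq_mul]
  field_simp
  linear_combination h1

theorem exists_ne_zero_dotProduct_eq_zero (φ : Fin 3 → ℂ) :
    ∃ v : Fin 3 → ℂ, v ≠ 0 ∧ φ ⬝ᵥ v = 0 := by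
  by_cases h : φ 0 = 0
  · exact ⟨![1, 0, 0], by simp, by simp [dotProduct, Fin.sum_univ_three, h]⟩
  · refine ⟨![φ 1, -φ 0, 0], fun hv => h ?_, ?_⟩
    · simpa using congrFun hv 1
    · simp [dotProduct, Fin.sum_univ_three, mul_comm]

theorem finrank_ker_dotProduct {φ : Fin 3 → ℂ} (hφ : φ ≠ 0) :
    Module.finrank ℂ (LinearMap.ker (dotProductBilin ℂ ℂ φ : (Fin 3 → ℂ) →ₗ[ℂ] ℂ)) = 2 := by
  have h1 := (dotProductBilin ℂ ℂ φ : (Fin 3 → ℂ) →ₗ[ℂ] ℂ).finrank_range_add_finrank_ker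
  have h2 : LinearMap.range (dotProductBilin ℂ ℂ φ : (Fin 3 → ℂ) →ₗ[ℂ] ℂ) = ⊤ := by
    rw [LinearMap.range_eq_top]
    refine LinearMap.surjective fun h0 => hφ (funext fun i => ?_)
    simpa using LinearMap.congr_fun h0 (Pi.single i 1)
  rw [h2, finrank_top, Module.finrank_self, Module.finrank_fintype_fun_eq_card,
    Fintype.card_fin] at h1
  omega

theorem setOf_submodule_le_ker (φ : Fin 3 → ℂ) :
    {p : P2 | p.submodule ≤ LinearMap.ker (dotProductBilin ℂ ℂ φ : (Fin 3 → ℂ) →ₗ[ℂ] ℂ)} =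
      lineOf φ := by
  ext p
  simp [lineOf, Projectivization.submodule_eq, Submodule.span_singleton_le_iff_mem]

theorem isComplexLine_lineOf {φ : Fin 3 → ℂ} (hφ : φ ≠ 0) : IsComplexLine (lineOf φ) :=
  ⟨_, finrank_ker_dotProduct hφ, (setOf_submodule_le_ker φ).symm⟩

theorem IsComplexLine.exists_lineOf {l : Set P2} (hl : IsComplexLine l) :
    ∃ φ : Fin 3 → ℂ, φ ≠ 0 ∧ l = lineOf φ := by
  obtain ⟨W, hW, rfl⟩ := hl
  have hlt : W < ⊤ := by
    refine lt_top_iff_ne_top.2 fun h => ?_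
    rw [h, finrank_top, Module.finrank_fintype_fun_eq_card, Fintype.card_fin] at hW
    omega
  obtain ⟨f, hf, hWf⟩ := W.exists_le_ker_of_lt_top hlt
  have hfd : f = dotProductBilin ℂ ℂ (fun i => f (Pi.single i 1)) := by
    ext i
    simp
  have h0 : (fun i => f (Pi.single i 1)) ≠ 0 := by
    intro h
    rw [h, map_zero] at hfd
    exact hf hfd
  refine ⟨_, h0, ?_⟩
  rw [← setOf_submodule_le_ker, ← hfd]
  congr! 3
  refine Submodule.eq_of_le_of_finrank_eq hWf ?_
  rw [hW, hfd, finrank_ker_dotProduct h0]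

/-- `A` contains the lines given by three linearly independent covectors. -/
def ContainsTriangle (A : Set P2) : Prop :=
  ∃ Φ : Fin 3 → Fin 3 → ℂ, (∀ v : Fin 3 → ℂ, (∀ i, Φ i ⬝ᵥ v = 0) → v = 0) ∧
    ∀ i, lineOf (Φ i) ⊆ A

theorem ContainsThreeLinesInGeneralPosition.containsTriangle {A : Set P2}
    (h : ContainsThreeLinesInGeneralPosition A) : ContainsTriangle A := by
  obtain ⟨l₁, l₂, l₃, h₁, h₂, h₃, -, -, -, hempty, hA₁, hA₂, hA₃⟩ := h
  obtain ⟨φ₁, -, rfl⟩ := h₁.exists_lineOf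
  obtain ⟨φ₂, -, rfl⟩ := h₂.exists_lineOf
  obtain ⟨φ₃, -, rfl⟩ := h₃.exists_lineOf
  refine ⟨![φ₁, φ₂, φ₃], fun v hv => ?_, fun i => by fin_cases i <;> assumption⟩
  by_contra h0
  have hmem : pt v ∈ lineOf φ₁ ∩ lineOf φ₂ ∩ lineOf φ₃ :=
    ⟨⟨(pt_mem_lineOf h0).2 (hv 0), (pt_mem_lineOf h0).2 (hv 1)⟩, (pt_mem_lineOf h0).2 (hv 2)⟩
  rw [hempty] at hmem
  exact hmem

theorem ContainsTriangle.mono {A B : Set P2} (h : ContainsTriangle A) (hAB : A ⊆ B) :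
    ContainsTriangle B := by
  obtain ⟨Φ, h1, h2⟩ := h
  exact ⟨Φ, h1, fun i => (h2 i).trans hAB⟩

theorem ContainsTriangle.not_subset_lineOf {A : Set P2} (h : ContainsTriangle A)
    {φ : Fin 3 → ℂ} (hφ : φ ≠ 0) : ¬ A ⊆ lineOf φ := by
  intro hA
  obtain ⟨Φ, h1, h2⟩ := h
  obtain ⟨v, hv, hφv⟩ := exists_ne_zero_dotProduct_eq_zero φ
  have hex : ∀ i, Φ i ≠ 0 := by
    intro i hi
    -- two of the covectors already have a common zero
    obtain ⟨w, hw, hw1, hw2⟩ : ∃ w : Fin 3 → ℂ, w ≠ 0 ∧ Φ (i + 1) ⬝ᵥ w = 0 ∧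
        Φ (i + 2) ⬝ᵥ w = 0 := by
      have hdet : (Matrix.of ![Φ (i + 1), Φ (i + 2), 0]).det = 0 :=
        Matrix.det_eq_zero_of_row_eq_zero 2 (fun j => by simp)
      obtain ⟨w, hw, hw0⟩ := Matrix.exists_mulVec_eq_zero_iff.2 hdet
      exact ⟨w, hw, by simpa using congrFun hw0 0, by simpa using congrFun hw0 1⟩
    refine hw (h1 w fun j => ?_)
    fin_cases i <;> fin_cases j <;> simp_all
  refine hv (h1 v fun i => ?_)
  obtain ⟨c, hc⟩ := exists_smul_eq_of_lineOf_subset (hex i) ((h2 i).trans hA)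
  have hc0 : c ≠ 0 := by
    rintro rfl
    exact hφ (by rw [hc, zero_smul])
  rw [hc, smul_dotProduct, smul_eq_zero] at hφv
  exact hφv.resolve_left hc0

theorem tendsto_dotProduct {ι : Type*} {l : Filter ι} {x y : ι → Fin 3 → ℂ} {v w : Fin 3 → ℂ}
    (hx : Tendsto x l (𝓝 v)) (hy : Tendsto y l (𝓝 w)) :
    Tendsto (fun i => x i ⬝ᵥ y i) l (𝓝 (v ⬝ᵥ w)) :=
  tendsto_finsetSum _ fun j _ => ((tendsto_pi_nhds.1 hx j).mul (tendsto_pi_nhds.1 hy j))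

theorem tendsto_mulVec {ι : Type*} {l : Filter ι} {X : ι → Matrix (Fin 3) (Fin 3) ℂ}
    {M : Matrix (Fin 3) (Fin 3) ℂ} {y : ι → Fin 3 → ℂ} {v : Fin 3 → ℂ}
    (hX : Tendsto X l (𝓝 M)) (hy : Tendsto y l (𝓝 v)) :
    Tendsto (fun i => X i *ᵥ y i) l (𝓝 (M *ᵥ v)) :=
  tendsto_pi_nhds.2 fun j => tendsto_dotProduct (tendsto_pi_nhds.1 hX j) hy

theorem tendsto_vecMul {ι : Type*} {l : Filter ι} {X : ι → Matrix (Fin 3) (Fin 3) ℂ}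
    {M : Matrix (Fin 3) (Fin 3) ℂ} (hX : Tendsto X l (𝓝 M)) (φ : Fin 3 → ℂ) :
    Tendsto (fun i => φ ᵥ* X i) l (𝓝 (φ ᵥ* M)) :=
  tendsto_pi_nhds.2 fun j => tendsto_dotProduct tendsto_const_nhds
    (tendsto_pi_nhds.2 fun i => tendsto_pi_nhds.1 (tendsto_pi_nhds.1 hX i) j)

theorem inv_val_mul_val (A : SL(3, ℂ)) : (A⁻¹).1 * A.1 = 1 :=
  (Matrix.SpecialLinearGroup.coe_mul A⁻¹ A).symm.trans (by simp)

theorem val_mul_inv_val (A : SL(3, ℂ)) : A.1 * (A⁻¹).1 = 1 :=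
  (Matrix.SpecialLinearGroup.coe_mul A A⁻¹).symm.trans (by simp)

theorem inv_mulVec_mulVec (A : SL(3, ℂ)) (v : Fin 3 → ℂ) : (A⁻¹).1 *ᵥ (A.1 *ᵥ v) = v := by
  rw [mulVec_mulVec, inv_val_mul_val, one_mulVec]

theorem mulVec_ne_zero (A : SL(3, ℂ)) {v : Fin 3 → ℂ} (hv : v ≠ 0) : A.1 *ᵥ v ≠ 0 := by
  intro h
  apply hv
  rw [← inv_mulVec_mulVec A v, h, mulVec_zero]

theorem smul_pt (A : SL(3, ℂ)) {v : Fin 3 → ℂ} (hv : v ≠ 0) :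
    (A : PSL(3, ℂ)) • pt v = pt (A.1 *ᵥ v) := by
  rw [pt_of_ne hv, pt_of_ne (mulVec_ne_zero A hv),
    Matrix.ProjectiveSpecialLinearGroup.smul_proj_mk]
  rfl

instance : ContinuousConstSMul PSL(3, ℂ) P2 := by
  refine ⟨fun γ => continuous_iff_continuousAt.2 fun p => ?_⟩
  obtain ⟨A, rfl⟩ := QuotientGroup.mk_surjective γ
  obtain ⟨v, hv, rfl⟩ := exists_pt p
  apply continuousAt_of_comp_pt hv
  have h : ContinuousAt (fun w => pt (A.1 *ᵥ w)) v :=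
    (continuousAt_pt (mulVec_ne_zero A hv)).comp (f := fun w => A.1 *ᵥ w)
      (Continuous.matrix_mulVec continuous_const continuous_id).continuousAt
  refine h.congr ?_
  filter_upwards [isOpen_ne.mem_nhds hv] with w hw
  exact (smul_pt A hw).symm

/-- Two lifts of the same element of `PSL(3, ℂ)` differ by a scalar of modulus one. -/
theorem exists_smul_eq_of_mk_eq {A B : SL(3, ℂ)} (h : (A : PSL(3, ℂ)) = B) :
    ∃ c : ℂ, ‖c‖ = 1 ∧ B.1 = c • A.1 := by
  obtain ⟨c, hc, hcA⟩ := Matrix.SpecialLinearGroup.mem_center_iff.1 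
    (QuotientGroup.eq (s := Subgroup.center SL(3, ℂ)).1 h)
  refine ⟨c, ?_, ?_⟩
  · exact Complex.norm_eq_one_of_pow_eq_one hc (by simp)
  · have h1 : B = A * (A⁻¹ * B) := by simp
    have h2 : B.1 = A.1 * (A⁻¹ * B).1 := congrArg Subtype.val h1
    rw [h2, ← hcA, scalar_apply, ← smul_one_eq_diagonal, Algebra.mul_smul_comm, mul_one]

/-! ### Degenerations of sequences of projective transformations -/

/-- The sequence `γ` degenerates to `M`, and the sequence of the inverses to `M'`: suitable lifts
`A n` to `SL(3, ℂ)`, multiplied by scalars which tend to zero, converge to the nonzero matrix `M`,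
and similarly the inverses of the `A n` converge to `M'`. -/
def Degenerates (γ : ℕ → PSL(3, ℂ)) (M M' : Matrix (Fin 3) (Fin 3) ℂ) : Prop :=
  M ≠ 0 ∧ M' ≠ 0 ∧ ∃ (A : ℕ → SL(3, ℂ)) (a b : ℕ → ℂ),
    (∀ n, (A n : PSL(3, ℂ)) = γ n) ∧ (∀ n, a n ≠ 0) ∧ (∀ n, b n ≠ 0) ∧
    Tendsto a atTop (𝓝 0) ∧ Tendsto b atTop (𝓝 0) ∧
    Tendsto (fun n => a n • (A n).1) atTop (𝓝 M) ∧
    Tendsto (fun n => b n • ((A n)⁻¹).1) atTop (𝓝 M')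

namespace Degenerates

variable {γ : ℕ → PSL(3, ℂ)} {M M' : Matrix (Fin 3) (Fin 3) ℂ}

theorem inv (h : Degenerates γ M M') : Degenerates (fun n => (γ n)⁻¹) M' M := by
  obtain ⟨hM, hM', A, a, b, hA, ha, hb, ha0, hb0, hlim, hlim'⟩ := h
  refine ⟨hM', hM, fun n => (A n)⁻¹, b, a, fun n => ?_, hb, ha, hb0, ha0, hlim', ?_⟩
  · change (((A n)⁻¹ : SL(3, ℂ)) : PSL(3, ℂ)) = (γ n)⁻¹
    rw [← hA n, QuotientGroup.mk_inv]
  · simpa using hlim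

theorem comp (h : Degenerates γ M M') {φ : ℕ → ℕ} (hφ : StrictMono φ) :
    Degenerates (fun n => γ (φ n)) M M' := by
  obtain ⟨hM, hM', A, a, b, hA, ha, hb, ha0, hb0, hlim, hlim'⟩ := h
  exact ⟨hM, hM', fun n => A (φ n), a ∘ φ, b ∘ φ, fun n => hA _, fun n => ha _, fun n => hb _,
    ha0.comp hφ.tendsto_atTop, hb0.comp hφ.tendsto_atTop, hlim.comp hφ.tendsto_atTop,
    hlim'.comp hφ.tendsto_atTop⟩

theorem mul_eq_zero (h : Degenerates γ M M') : M * M' = 0 := by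
  obtain ⟨-, -, A, a, b, -, -, -, ha0, hb0, hlim, hlim'⟩ := h
  refine tendsto_nhds_unique (hlim.mul hlim') ?_
  have h1 : ∀ n, (a n • (A n).1) * (b n • ((A n)⁻¹).1) =
      (a n * b n) • (1 : Matrix (Fin 3) (Fin 3) ℂ) := by
    intro n
    rw [smul_mul_smul_comm, val_mul_inv_val]
  simp only [h1]
  simpa using (ha0.mul hb0).smul_const (1 : Matrix (Fin 3) (Fin 3) ℂ)

theorem mul_eq_zero' (h : Degenerates γ M M') : M' * M = 0 := h.inv.mul_eq_zero

/-- Off the kernel of its limit, a degenerating sequence converges locally uniformly. -/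
theorem tendsto_smul (h : Degenerates γ M M') {x : ℕ → P2} {v : Fin 3 → ℂ} (hv : M *ᵥ v ≠ 0)
    (hx : Tendsto x atTop (𝓝 (pt v))) : Tendsto (fun n => γ n • x n) atTop (𝓝 (pt (M *ᵥ v))) := by
  obtain ⟨-, -, A, a, b, hA, ha, hb, ha0, hb0, hlim, hlim'⟩ := h
  have hv0 : v ≠ 0 := by
    rintro rfl
    simp at hv
  obtain ⟨y, hy, hyx, hylim⟩ := exists_lift_tendsto hv0 hx
  have h1 := tendsto_mulVec hlim hylim
  refine (tendsto_pt hv h1).congr fun n => ?_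
  rw [smul_mulVec, pt_smul (ha n) (mulVec_ne_zero _ (hy n)), ← smul_pt _ (hy n), hyx, hA]

theorem tendsto_cofinite (h : Degenerates γ M M') : Tendsto γ atTop cofinite := by
  obtain ⟨hM, -, A, a, b, hA, ha, hb, ha0, hb0, hlim, hlim'⟩ := h
  rw [← Nat.cofinite_eq_atTop]
  refine Tendsto.cofinite_of_finite_preimage_singleton fun g => ?_
  by_contra hinf
  obtain ⟨φ, hφ, hφg⟩ := extraction_of_frequently_atTop
    (Nat.frequently_atTop_iff_infinite.2 (Set.not_finite.1 hinf :
      {n | γ n ∈ ({g} : Set _)}.Infinite))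
  -- the lifts of a fixed element stay bounded, so that rescaling sends them to zero
  choose c hc hcA using fun n => exists_smul_eq_of_mk_eq
    (A := A (φ 0)) (B := A (φ n)) (by rw [hA, hA, hφg 0, hφg n])
  have h1 : Tendsto (fun n => a (φ n) * c n) atTop (𝓝 0) := by
    refine squeeze_zero_norm (fun n => ?_) ((tendsto_zero_iff_norm_tendsto_zero.1 ha0).comp
      hφ.tendsto_atTop)
    rw [norm_mul, hc, mul_one, Function.comp]
  have h2 : Tendsto (fun n => a (φ n) • (A (φ n)).1) atTop (𝓝 0) := by
    have := h1.smul_const (A (φ 0)).1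
    rw [zero_smul] at this
    refine this.congr fun n => ?_
    rw [hcA n, smul_smul]
  exact hM (tendsto_nhds_unique (hlim.comp hφ.tendsto_atTop) h2)

end Degenerates

theorem exists_subseq_tendsto_normalized {E : Type*} [NormedAddCommGroup E] [NormedSpace ℂ E]
    [ProperSpace E] (x : ℕ → E) (hx : ∀ n, x n ≠ 0) :
    ∃ φ : ℕ → ℕ, StrictMono φ ∧ ∃ y : E, y ≠ 0 ∧
      Tendsto (fun n => ((‖x (φ n)‖ : ℂ)⁻¹) • x (φ n)) atTop (𝓝 y) := by
  obtain ⟨y, hy, φ, hφ, hlim⟩ := (isCompact_sphere (0 : E) 1).tendsto_subseq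
    (x := fun n => ((‖x n‖ : ℂ)⁻¹) • x n) (fun n => by
      rw [mem_sphere_zero_iff_norm, norm_smul, norm_inv, Complex.norm_real, norm_norm,
        inv_mul_cancel₀ (norm_ne_zero_iff.2 (hx n))])
  refine ⟨φ, hφ, y, ?_, hlim⟩
  rintro rfl
  simp at hy

section DiscreteSubgroup

open scoped Matrix.Norms.Elementwise

/-- In a discrete subgroup, pairwise distinct elements have lifts whose entries tend to infinity. -/
theorem tendsto_norm_lift_atTop {Γ : Subgroup PSL(3, ℂ)} (hΓ : DiscreteTopology Γ)
    {A : ℕ → SL(3, ℂ)} (hA : ∀ n, (A n : PSL(3, ℂ)) ∈ Γ)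
    (hinj : Function.Injective fun n => (A n : PSL(3, ℂ))) :
    Tendsto (fun n => ‖(A n).1‖) atTop atTop := by
  by_contra hcon
  obtain ⟨R, hR⟩ : ∃ R : ℝ, ∃ᶠ n in atTop, ‖(A n).1‖ ≤ R := by
    by_contra hc
    push Not at hc
    refine hcon (tendsto_atTop.2 fun R => ?_)
    filter_upwards [hc R] with n hn
    exact hn.le
  obtain ⟨ψ, hψ, hψR⟩ := extraction_of_frequently_atTop hR
  obtain ⟨B, -, φ, hφ, hlim⟩ := tendsto_subseq_of_bounded
    (Metric.isBounded_closedBall (x := (0 : Matrix (Fin 3) (Fin 3) ℂ)) (r := R))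
    (x := fun n => (A (ψ n)).1) (fun n => by simpa using hψR n)
  have hdet : B.det = 1 := by
    refine tendsto_nhds_unique ((continuous_id.matrix_det.tendsto B).comp hlim) ?_
    refine tendsto_const_nhds.congr fun n => ?_
    simp
  let θ : ℕ → ℕ := fun n => ψ (φ n)
  have hθ : StrictMono θ := hψ.comp hφ
  let B' : SL(3, ℂ) := ⟨B, hdet⟩
  have hlimSL : Tendsto (fun n => A (θ n)) atTop (𝓝 B') := tendsto_subtype_rng.2 hlim
  have hlimP : Tendsto (fun n => (A (θ n) : PSL(3, ℂ))) atTop (𝓝 (B' : PSL(3, ℂ))) :=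
    (QuotientGroup.continuous_mk.tendsto _).comp hlimSL
  -- consecutive quotients tend to the identity inside `Γ`
  have hquot : Tendsto (fun n => (A (θ n) : PSL(3, ℂ)) * (A (θ (n + 1)) : PSL(3, ℂ))⁻¹) atTop
      (𝓝 1) := by
    have := hlimP.mul (hlimP.comp (tendsto_add_atTop_nat 1)).inv
    rwa [mul_inv_cancel] at this
  have hquotΓ : Tendsto (fun n => (⟨_, Γ.mul_mem (hA (θ n)) (Γ.inv_mem (hA (θ (n + 1))))⟩ : Γ))
      atTop (𝓝 1) := tendsto_subtype_rng.2 hquot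
  rw [nhds_discrete, tendsto_pure] at hquotΓ
  obtain ⟨n, hn⟩ := hquotΓ.exists
  have h1 := mul_inv_eq_one.1 (congrArg Subtype.val hn)
  exact absurd (hθ.injective (hinj h1)) (by simp)

/-- Every sequence of pairwise distinct elements of a discrete group has a degenerating
subsequence. -/
theorem exists_subseq_degenerates {Γ : Subgroup PSL(3, ℂ)} (hΓ : DiscreteTopology Γ)
    {γ : ℕ → PSL(3, ℂ)} (hγ : ∀ n, γ n ∈ Γ) (hinj : Function.Injective γ) :
    ∃ φ : ℕ → ℕ, StrictMono φ ∧ ∃ M M', Degenerates (fun n => γ (φ n)) M M' := by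
  choose A hA using fun n => QuotientGroup.mk_surjective (γ n)
  have hne : ∀ B : SL(3, ℂ), B.1 ≠ 0 := fun B h => by
    have := B.2
    rw [h] at this
    simp at this
  have h1 : Tendsto (fun n => ‖(A n).1‖) atTop atTop :=
    tendsto_norm_lift_atTop hΓ (fun n => by rw [hA]; exact hγ n) (by simpa only [hA] using hinj)
  have h2 : Tendsto (fun n => ‖((A n)⁻¹).1‖) atTop atTop := by
    refine tendsto_norm_lift_atTop hΓ (fun n => ?_) ?_
    · rw [QuotientGroup.mk_inv, hA]
      exact Γ.inv_mem (hγ n)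
    · simp only [QuotientGroup.mk_inv, hA]
      exact inv_injective.comp hinj
  obtain ⟨φ, hφ, M, hM, hlim⟩ := exists_subseq_tendsto_normalized (fun n => (A n).1)
    (fun n => hne _)
  obtain ⟨ψ, hψ, M', hM', hlim'⟩ := exists_subseq_tendsto_normalized
    (fun n => ((A (φ n))⁻¹).1) (fun n => hne _)
  have hinv : ∀ u : ℕ → ℝ, Tendsto u atTop atTop →
      Tendsto (fun n => ((u n : ℂ))⁻¹) atTop (𝓝 0) := by
    intro u hu
    have := (Complex.continuous_ofReal.tendsto 0).comp (tendsto_inv_atTop_zero.comp hu)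
    simpa [Function.comp_def] using this
  refine ⟨φ ∘ ψ, hφ.comp hψ, M, M', hM, hM', fun n => A (φ (ψ n)),
    fun n => (‖(A (φ (ψ n))).1‖ : ℂ)⁻¹, fun n => (‖((A (φ (ψ n)))⁻¹).1‖ : ℂ)⁻¹,
    fun n => hA _, fun n => ?_, fun n => ?_, ?_, ?_, ?_, hlim'⟩
  · simpa using hne _
  · simpa using norm_ne_zero_iff.2 (hne (A (φ (ψ n)))⁻¹)
  · exact hinv _ (h1.comp (hφ.comp hψ).tendsto_atTop)
  · exact hinv _ (h2.comp (hφ.comp hψ).tendsto_atTop)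
  · exact hlim.comp hψ.tendsto_atTop

end DiscreteSubgroup

/-! ### The equicontinuity set -/

theorem exists_mulVec_ne_zero {M : Matrix (Fin 3) (Fin 3) ℂ} (hM : M ≠ 0) :
    ∃ w : Fin 3 → ℂ, M *ᵥ w ≠ 0 := by
  by_contra hc
  push Not at hc
  exact hM (Matrix.ext_of_mulVec_single fun i => by rw [hc, zero_mulVec])

theorem pt_mulVec_rep {M : Matrix (Fin 3) (Fin 3) ℂ} {v : Fin 3 → ℂ} (hv : M *ᵥ v ≠ 0) :
    pt (M *ᵥ (pt v).rep) = pt (M *ᵥ v) := by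
  have hv0 : v ≠ 0 := by
    rintro rfl
    simp at hv
  obtain ⟨a, ha⟩ := (pt_eq_pt_iff (pt v).rep_nonzero hv0).1 (pt_rep (pt v))
  have ha0 : a ≠ 0 := by
    rintro rfl
    exact (pt v).rep_nonzero (by rw [← ha, zero_smul])
  rw [← ha, mulVec_smul, pt_smul ha0 hv]

/-- A discrete group is a normal family on every open set which avoids the kernels of all limits of
its sequences. -/
theorem isNormalFamilyOn_of_forall_mulVec_ne_zero {Γ : Subgroup PSL(3, ℂ)}
    (hΓ : DiscreteTopology Γ) {U : Set P2}
    (hU : ∀ γ M M', (∀ n, γ n ∈ Γ) → Degenerates γ M M' →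
      ∀ v : Fin 3 → ℂ, v ≠ 0 → pt v ∈ U → M *ᵥ v ≠ 0) :
    IsNormalFamilyOn (Γ : Set PSL(3, ℂ)) U := by
  intro γ hγ hinj
  obtain ⟨φ, hφ, M, M', hdeg⟩ := exists_subseq_degenerates hΓ hγ hinj
  refine ⟨φ, hφ, fun p => pt (M *ᵥ p.rep), fun K hK hKU ε hε => ?_⟩
  have hker := hU _ M M' (fun n => hγ (φ n)) hdeg
  obtain ⟨-, -, A, a, b, hA, ha, hb, ha0, hb0, hlim, hlim'⟩ := hdeg
  -- work on the compact set of unit vectors above `K`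
  have hK' : IsCompact (Metric.sphere (0 : Fin 3 → ℂ) 1 ∩ pt ⁻¹' K) := by
    refine (isCompact_sphere (0 : Fin 3 → ℂ) 1).of_isClosed_subset ?_ inter_subset_left
    refine ContinuousOn.preimage_isClosed_of_isClosed (fun v hv => ?_) Metric.isClosed_sphere
      hK.isClosed
    exact (continuousAt_pt (ne_zero_of_norm_one (by simpa using hv))).continuousWithinAt
  have huni : ∀ᶠ X in 𝓝 M, ∀ v ∈ Metric.sphere (0 : Fin 3 → ℂ) 1 ∩ pt ⁻¹' K,
      hermitianAngle (X *ᵥ v) (M *ᵥ v) < ε := by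
    refine hK'.eventually_forall_of_forall_eventually fun v hv => ?_
    have hv0 : v ≠ 0 := ne_zero_of_norm_one (by simpa using hv.1)
    have hMv : M *ᵥ v ≠ 0 := hker v hv0 (hKU hv.2)
    have h1 : Tendsto (fun z : Matrix (Fin 3) (Fin 3) ℂ × (Fin 3 → ℂ) => (z.1 *ᵥ z.2, M *ᵥ z.2))
        (𝓝 (M, v)) (𝓝 (M *ᵥ v, M *ᵥ v)) := by
      rw [nhds_prod_eq (x := M *ᵥ v)]
      refine Tendsto.prodMk (tendsto_mulVec continuous_fst.continuousAt
        continuous_snd.continuousAt) (tendsto_mulVec tendsto_const_nhds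
        continuous_snd.continuousAt)
    have h2 := (continuousAt_hermitianAngle hMv hMv).tendsto.comp h1
    simp only [hermitianAngle_self hMv] at h2
    exact h2.eventually (gt_mem_nhds hε)
  obtain ⟨N, hN⟩ := eventually_atTop.1 (hlim.eventually huni)
  refine ⟨N, fun n hn p hp => ?_⟩
  obtain ⟨v, hv, rfl⟩ := exists_pt_norm_one p
  have hv0 := ne_zero_of_norm_one hv
  have hMv := hker v hv0 (hKU hp)
  have hX : (a n • (A n).1) *ᵥ v = a n • ((A n).1 *ᵥ v) := smul_mulVec _ _ _
  have h := hN n hn v ⟨by simpa using hv, hp⟩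
  rw [hX] at h
  replace hA : (A n : PSL(3, ℂ)) = γ (φ n) := hA n
  change fubiniStudyDist (γ (φ n) • pt v) (pt (M *ᵥ (pt v).rep)) < ε
  rw [← hA, smul_pt _ hv0, pt_mulVec_rep hMv, ← pt_smul (ha n) (mulVec_ne_zero _ hv0),
    fubiniStudyDist_pt (smul_ne_zero (ha n) (mulVec_ne_zero _ hv0)) hMv]
  exact h

/-- If the covectors `ψ n` converge to `χ`, then every zero `v` of `χ` is the limit of zeros
`v + t n • w` of the `ψ n`, on any line through `v` transverse to the kernel of `χ`. -/
theorem exists_tendsto_zero_dotProduct_eq_zero {ψ : ℕ → Fin 3 → ℂ} {χ v w : Fin 3 → ℂ}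
    (hψ : Tendsto ψ atTop (𝓝 χ)) (hv : χ ⬝ᵥ v = 0) (hw : χ ⬝ᵥ w ≠ 0) :
    ∃ t : ℕ → ℂ, Tendsto t atTop (𝓝 0) ∧ ∀ᶠ n in atTop, ψ n ⬝ᵥ (v + t n • w) = 0 := by
  have h1 := tendsto_dotProduct hψ (tendsto_const_nhds (x := v))
  have h2 := tendsto_dotProduct hψ (tendsto_const_nhds (x := w))
  refine ⟨fun n => -((ψ n ⬝ᵥ v) / (ψ n ⬝ᵥ w)), ?_, ?_⟩
  · simpa [hv] using (h1.div h2 hw).neg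
  · filter_upwards [h2.eventually_ne hw] with n hn
    rw [dotProduct_add, dotProduct_smul, smul_eq_mul]
    field_simp
    ring

theorem exists_dotProduct_ne_zero {v : Fin 3 → ℂ} (hv : v ≠ 0) :
    ∃ φ : Fin 3 → ℂ, φ ⬝ᵥ v ≠ 0 := by
  by_contra hc
  push Not at hc
  exact hv (funext fun i => by simpa using hc (Pi.single i 1))

/-- Points of the equicontinuity set avoid the kernels of the limits of sequences of distinct
elements: near a point of the kernel, the sequence takes values far away from the limit. -/
theorem mulVec_ne_zero_of_mem_equicontinuitySet {F : Set PSL(3, ℂ)} {γ : ℕ → PSL(3, ℂ)}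
    (hγ : ∀ n, γ n ∈ F) (hinj : Function.Injective γ) {M M' : Matrix (Fin 3) (Fin 3) ℂ}
    (hdeg : Degenerates γ M M') {v : Fin 3 → ℂ} (hv : v ≠ 0) (hz : pt v ∈ equicontinuitySet F) :
    M *ᵥ v ≠ 0 := by
  intro hMv
  obtain ⟨U, hU, hvU, hnormal⟩ := hz
  obtain ⟨φ, hφ, g, hg⟩ := hnormal γ hγ hinj
  have hdegφ := hdeg.comp hφ
  obtain ⟨w, hw⟩ := exists_mulVec_ne_zero hdeg.1
  have hne : ∀ t : ℂ, v + t • w ≠ 0 := by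
    intro t ht
    have h1 := congrArg (M *ᵥ ·) ht
    simp only [mulVec_add, hMv, mulVec_smul, zero_add, mulVec_zero, smul_eq_zero, hw,
      or_false] at h1
    rw [h1, zero_smul, add_zero] at ht
    exact hv ht
  have hcont : Continuous fun t : ℂ => pt (v + t • w) := by
    refine continuous_iff_continuousAt.2 fun t => ?_
    exact tendsto_pt (hne t) (Continuous.tendsto (by fun_prop) t)
  have hnear : ∀ᶠ t in 𝓝 (0 : ℂ), pt (v + t • w) ∈ U := by
    refine hcont.continuousAt.eventually_mem (hU.mem_nhds ?_)
    simpa using hvU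
  obtain ⟨r, hr, hrU⟩ := Metric.nhds_basis_closedBall.mem_iff.1 hnear
  have hconv := hg ((fun t : ℂ => pt (v + t • w)) '' Metric.closedBall 0 r)
    ((isCompact_closedBall (0 : ℂ) r).image hcont) (by rintro _ ⟨t, ht, rfl⟩; exact hrU ht)
  have hgt : ∀ t ∈ Metric.closedBall (0 : ℂ) r, t ≠ 0 → g (pt (v + t • w)) = pt (M *ᵥ w) := by
    intro t ht ht0
    have hMt : M *ᵥ (v + t • w) = t • (M *ᵥ w) := by
      rw [mulVec_add, hMv, zero_add, mulVec_smul]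
    have h1 := hdegφ.tendsto_smul (by rw [hMt]; exact smul_ne_zero ht0 hw)
      (tendsto_const_nhds (x := pt (v + t • w)))
    rw [hMt, pt_smul ht0 hw] at h1
    refine tendsto_nhds_unique (tendsto_of_tendsto_fubiniStudyDist ?_) h1
    rw [Metric.tendsto_atTop]
    intro ε hε
    obtain ⟨N, hN⟩ := hconv ε hε
    refine ⟨N, fun n hn => ?_⟩
    rw [Real.dist_0_eq_abs, abs_of_nonneg (fubiniStudyDist_nonneg _ _)]
    exact hN n hn _ ⟨t, ht, rfl⟩
  -- the convergence to `pt (M *ᵥ w)` is uniform, the point `t = 0` included by continuity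
  have huni : ∀ ε : ℝ, 0 < ε → ∃ N, ∀ n, N ≤ n → ∀ t ∈ Metric.closedBall (0 : ℂ) r,
      fubiniStudyDist (γ (φ n) • pt (v + t • w)) (pt (M *ᵥ w)) ≤ ε := by
    intro ε hε
    obtain ⟨N, hN⟩ := hconv ε hε
    refine ⟨N, fun n hn t ht => ?_⟩
    have hne0 : ∀ s ∈ Metric.closedBall (0 : ℂ) r, s ≠ 0 →
        fubiniStudyDist (γ (φ n) • pt (v + s • w)) (pt (M *ᵥ w)) ≤ ε := by
      intro s hs hs0
      rw [← hgt s hs hs0]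
      exact (hN n hn _ ⟨s, hs, rfl⟩).le
    by_cases ht0 : t = 0
    · subst ht0
      have hc : Continuous fun s : ℂ =>
          fubiniStudyDist (γ (φ n) • pt (v + s • w)) (pt (M *ᵥ w)) :=
        (continuous_fubiniStudyDist_right _).comp
            ((continuous_const_smul (γ (φ n))).comp hcont)
      refine le_of_tendsto (hc.continuousAt.tendsto.mono_left
        (nhdsWithin_le_nhds (s := {0}ᶜ))) ?_
      filter_upwards [self_mem_nhdsWithin, mem_nhdsWithin_of_mem_nhds
        (Metric.closedBall_mem_nhds (0 : ℂ) hr)] with s hs0 hs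
      exact hne0 s hs hs0
    · exact hne0 t ht ht0
  obtain ⟨χ, hχ⟩ := exists_dotProduct_ne_zero hw
  obtain ⟨-, -, A, a, b, hA, ha, hb, ha0, hb0, hlim, hlim'⟩ := hdegφ
  obtain ⟨t, ht, htzero⟩ := exists_tendsto_zero_dotProduct_eq_zero (v := v) (w := w)
    (tendsto_vecMul hlim χ) (by rw [← dotProduct_mulVec, hMv, dotProduct_zero])
    (by rwa [← dotProduct_mulVec])
  have htball : ∀ᶠ n in atTop, t n ∈ Metric.closedBall (0 : ℂ) r :=
    ht.eventually_mem (Metric.closedBall_mem_nhds (0 : ℂ) hr)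
  have hlimq : Tendsto (fun n => γ (φ n) • pt (v + t n • w)) atTop (𝓝 (pt (M *ᵥ w))) := by
    apply tendsto_of_tendsto_fubiniStudyDist
    rw [Metric.tendsto_atTop']
    intro ε hε
    obtain ⟨N, hN⟩ := huni (ε / 2) (half_pos hε)
    obtain ⟨N', hN'⟩ := eventually_atTop.1 htball
    refine ⟨max N N', fun n hn => ?_⟩
    rw [Real.dist_0_eq_abs, abs_of_nonneg (fubiniStudyDist_nonneg _ _)]
    exact (hN n ((le_max_left _ _).trans hn.le) _
      (hN' n ((le_max_right _ _).trans hn.le))).trans_lt (half_lt_self hε)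
  refine hχ ((pt_mem_lineOf hw).1 ((isClosed_lineOf χ).mem_of_tendsto hlimq ?_))
  filter_upwards [htzero] with n hn
  replace hA : (A n : PSL(3, ℂ)) = γ (φ n) := hA n
  rw [← hA, smul_pt _ (hne _), pt_mem_lineOf (mulVec_ne_zero _ (hne _))]
  rw [← dotProduct_mulVec, smul_mulVec, dotProduct_smul, smul_eq_zero] at hn
  exact hn.resolve_left (ha n)

theorem isOpen_equicontinuitySet (F : Set PSL(3, ℂ)) : IsOpen (equicontinuitySet F) := by
  refine isOpen_iff_forall_mem_open.2 fun z hz => ?_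
  obtain ⟨U, hU, hzU, h⟩ := hz
  exact ⟨U, fun y hy => ⟨U, hU, hy, h⟩, hU, hzU⟩

theorem equicontinuitySet_anti {F F' : Set PSL(3, ℂ)} (h : F ⊆ F') :
    equicontinuitySet F' ⊆ equicontinuitySet F := by
  rintro z ⟨U, hU, hzU, hn⟩
  exact ⟨U, hU, hzU, fun γ hγ hinj => hn γ (fun n => h (hγ n)) hinj⟩

theorem smul_mem_equicontinuitySet {Γ : Subgroup PSL(3, ℂ)} {h : PSL(3, ℂ)} (hh : h ∈ Γ) {z : P2}
    (hz : z ∈ equicontinuitySet (Γ : Set PSL(3, ℂ))) :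
    h • z ∈ equicontinuitySet (Γ : Set PSL(3, ℂ)) := by
  obtain ⟨U, hU, hzU, hn⟩ := hz
  refine ⟨(fun x => h⁻¹ • x) ⁻¹' U, hU.preimage (continuous_const_smul _), by simpa using hzU,
    fun γ hγ hinj => ?_⟩
  obtain ⟨φ, hφ, g, hg⟩ := hn (fun n => γ n * h) (fun n => Γ.mul_mem (hγ n) hh)
    ((mul_left_injective h).comp hinj)
  refine ⟨φ, hφ, fun x => g (h⁻¹ • x), fun K hK hKU ε hε => ?_⟩
  obtain ⟨N, hN⟩ := hg ((fun x => h⁻¹ • x) '' K) (hK.image (continuous_const_smul _))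
    (image_subset_iff.2 hKU) ε hε
  refine ⟨N, fun n hn x hx => ?_⟩
  have := hN n hn _ ⟨x, hx, rfl⟩
  simpa [mul_smul] using this

/-- Proper discontinuity on the equicontinuity set, in terms of sequences. -/
theorem notMem_equicontinuitySet_of_tendsto {Γ : Subgroup PSL(3, ℂ)} (hΓ : DiscreteTopology Γ)
    {γ : ℕ → PSL(3, ℂ)} (hγ : ∀ n, γ n ∈ Γ) (hinj : Function.Injective γ) {x : ℕ → P2} {p q : P2}
    (hx : Tendsto x atTop (𝓝 p)) (hγx : Tendsto (fun n => γ n • x n) atTop (𝓝 q))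
    (hp : p ∈ equicontinuitySet (Γ : Set PSL(3, ℂ))) :
    q ∉ equicontinuitySet (Γ : Set PSL(3, ℂ)) := by
  intro hq
  obtain ⟨φ, hφ, M, M', hdeg⟩ := exists_subseq_degenerates hΓ hγ hinj
  obtain ⟨v, hv, rfl⟩ := exists_pt p
  have hMv := mulVec_ne_zero_of_mem_equicontinuitySet (fun n => hγ (φ n))
    (hinj.comp hφ.injective) hdeg hv hp
  have hlim := hdeg.tendsto_smul hMv (hx.comp hφ.tendsto_atTop)
  rw [tendsto_nhds_unique (hγx.comp hφ.tendsto_atTop) hlim] at hq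
  refine mulVec_ne_zero_of_mem_equicontinuitySet (γ := fun n => (γ (φ n))⁻¹)
    (fun n => Γ.inv_mem (hγ (φ n)))
    (inv_injective.comp (hinj.comp hφ.injective)) hdeg.inv hMv hq ?_
  rw [mulVec_mulVec, hdeg.mul_eq_zero', zero_mulVec]

theorem actsProperlyDiscontinuouslyOn_equicontinuitySet {Γ : Subgroup PSL(3, ℂ)}
    (hΓ : DiscreteTopology Γ) :
    ActsProperlyDiscontinuouslyOn Γ (equicontinuitySet (Γ : Set PSL(3, ℂ))) := by
  refine ⟨fun γ hγ x hx => smul_mem_equicontinuitySet hγ hx, fun K hK hKU => ?_⟩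
  by_contra hinf
  let e := Set.Infinite.natEmbedding _ hinf
  choose x hx using fun n => (e n).2.2
  choose y hy using fun n => (hx n).1
  have hinj : Function.Injective fun n => (e n).1 := Subtype.val_injective.comp e.injective
  obtain ⟨φ, u, v, hφ, hv, -, hu, hlim⟩ := exists_subseq_lift y
  obtain ⟨ψ, u', v', hψ, hv', -, hu', hlim'⟩ := exists_subseq_lift (x ∘ φ)
  have h1 : Tendsto (fun n => y (φ n)) atTop (𝓝 (pt v)) := (tendsto_pt hv hlim).congr hu
  have h2 : Tendsto (fun n => x (φ (ψ n))) atTop (𝓝 (pt v')) := (tendsto_pt hv' hlim').congr hu'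
  refine notMem_equicontinuitySet_of_tendsto hΓ (γ := fun n => (e (φ (ψ n))).1)
    (fun n => (e (φ (ψ n))).2.1) (hinj.comp (hφ.injective.comp hψ.injective))
    (h1.comp hψ.tendsto_atTop) ?_
    (hKU (hK.isClosed.mem_of_tendsto h1 (Eventually.of_forall fun n => (hy _).1)))
    (hKU (hK.isClosed.mem_of_tendsto h2 (Eventually.of_forall fun n => (hx _).2)))
  exact h2.congr fun n => (hy (φ (ψ n))).2.symm

/-! ### The equicontinuity set lies in Kulkarni's discontinuity region -/

theorem L0_subset_compl_equicontinuitySet {Γ : Subgroup PSL(3, ℂ)} (hΓ : DiscreteTopology Γ) :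
    L0 Γ ⊆ (equicontinuitySet (Γ : Set PSL(3, ℂ)))ᶜ := by
  refine closure_minimal (fun z hz hzE => ?_) (isOpen_equicontinuitySet _).isClosed_compl
  let e := Set.Infinite.natEmbedding _ hz
  refine notMem_equicontinuitySet_of_tendsto hΓ (γ := fun n => (e n).1) (fun n => (e n).2.1)
    (Subtype.val_injective.comp e.injective) (tendsto_const_nhds (x := z)) ?_ hzE hzE
  exact tendsto_const_nhds.congr fun n => (e n).2.2.symm

theorem L1_subset_compl_equicontinuitySet {Γ : Subgroup PSL(3, ℂ)} (hΓ : DiscreteTopology Γ) :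
    L1 Γ ⊆ (equicontinuitySet (Γ : Set PSL(3, ℂ)))ᶜ := by
  refine closure_minimal ?_ (isOpen_equicontinuitySet _).isClosed_compl
  refine iUnion₂_subset fun z _ => ?_
  rintro q ⟨k, γ, hk, hγ, hinj, hlim⟩ hq
  obtain ⟨n, hn⟩ := (hlim.eventually ((isOpen_equicontinuitySet _).mem_nhds hq)).exists
  -- the set is invariant, so that the whole orbit lies in it
  have hz : z ∈ equicontinuitySet (Γ : Set PSL(3, ℂ)) := by
    have := smul_mem_equicontinuitySet (Γ.inv_mem (hγ n)) hn
    rwa [inv_smul_smul, hk n] at this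
  refine notMem_equicontinuitySet_of_tendsto hΓ hγ hinj
    (tendsto_const_nhds.congr fun n => (hk n).symm) hlim hz hq

theorem L2_subset_compl_equicontinuitySet {Γ : Subgroup PSL(3, ℂ)} (hΓ : DiscreteTopology Γ) :
    L2 Γ ⊆ (equicontinuitySet (Γ : Set PSL(3, ℂ)))ᶜ := by
  refine closure_minimal ?_ (isOpen_equicontinuitySet _).isClosed_compl
  rintro q ⟨K, hK, hKL, k, γ, hk, hγ, hinj, hlim⟩ hq
  obtain ⟨φ, u, v, hφ, hv, -, hu, hulim⟩ := exists_subseq_lift k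
  have hkv : Tendsto (fun n => k (φ n)) atTop (𝓝 (pt v)) := (tendsto_pt hv hulim).congr hu
  have hvK : pt v ∈ K := hK.isClosed.mem_of_tendsto hkv (Eventually.of_forall fun n => hk _)
  obtain ⟨ψ, hψ, M, M', hdeg⟩ := exists_subseq_degenerates hΓ (fun n => hγ (φ n))
    (hinj.comp hφ.injective)
  have hinj' : Function.Injective fun n => (γ (φ (ψ n)))⁻¹ :=
    inv_injective.comp (hinj.comp (hφ.injective.comp hψ.injective))
  obtain ⟨y, hy, rfl⟩ := exists_pt q
  have hM'y := mulVec_ne_zero_of_mem_equicontinuitySet (F := (Γ : Set PSL(3, ℂ)))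
    (fun n => Γ.inv_mem (hγ (φ (ψ n)))) hinj' hdeg.inv hy hq
  -- the point `pt v` of `K` is also the limit of the orbit of `q` itself
  have h1 : Tendsto (fun n => k (φ (ψ n))) atTop (𝓝 (pt (M' *ᵥ y))) := by
    refine (hdeg.inv.tendsto_smul hM'y
      (hlim.comp (hφ.comp hψ).tendsto_atTop)).congr fun n => ?_
    simp
  have h2 := hdeg.inv.tendsto_smul hM'y (tendsto_const_nhds (x := pt y))
  have h3 := tendsto_nhds_unique (hkv.comp hψ.tendsto_atTop) h1
  refine hKL hvK (Or.inr (subset_closure (mem_iUnion₂.2 ⟨pt y, fun hL =>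
    L0_subset_compl_equicontinuitySet hΓ hL hq, ?_⟩)))
  rw [h3]
  exact ⟨fun _ => pt y, _, fun _ => rfl, fun n => Γ.inv_mem (hγ _), hinj', h2⟩

theorem equicontinuitySet_subset_discontinuityRegion {Γ : Subgroup PSL(3, ℂ)}
    (hΓ : DiscreteTopology Γ) :
    equicontinuitySet (Γ : Set PSL(3, ℂ)) ⊆ discontinuityRegion Γ := by
  rintro z hz ((h | h) | h)
  · exact L0_subset_compl_equicontinuitySet hΓ h hz
  · exact L1_subset_compl_equicontinuitySet hΓ h hz
  · exact L2_subset_compl_equicontinuitySet hΓ h hz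

/-! ### Lines in closed invariant sets -/

/-- A limit of lines contained in a closed set is contained in it. -/
theorem lineOf_subset_of_tendsto {F : Set P2} (hF : IsClosed F) {ψ : ℕ → Fin 3 → ℂ}
    {χ : Fin 3 → ℂ} (hχ : χ ≠ 0) (hψ : Tendsto ψ atTop (𝓝 χ)) (h : ∀ n, lineOf (ψ n) ⊆ F) :
    lineOf χ ⊆ F := by
  intro p hp
  obtain ⟨v, hv, rfl⟩ := exists_pt p
  obtain ⟨w, hw⟩ := exists_dotProduct_ne_zero hχ
  rw [dotProduct_comm] at hw
  obtain ⟨t, ht, hzero⟩ := exists_tendsto_zero_dotProduct_eq_zero hψ ((pt_mem_lineOf hv).1 hp) hw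
  have hlim : Tendsto (fun n => v + t n • w) atTop (𝓝 v) := by
    simpa using (ht.smul_const w).const_add v
  refine hF.mem_of_tendsto (tendsto_pt hv hlim) ?_
  filter_upwards [hzero, hlim.eventually_ne hv] with n hn hn0
  exact h n ((pt_mem_lineOf hn0).2 hn)

theorem lineOf_vecMul_subset_of_mem {Γ : Subgroup PSL(3, ℂ)} {F : Set P2}
    (hinv : ∀ γ ∈ Γ, ∀ x ∈ F, γ • x ∈ F) {A : SL(3, ℂ)} (hA : (A : PSL(3, ℂ)) ∈ Γ)
    {φ : Fin 3 → ℂ} (hφ : lineOf φ ⊆ F) :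
    lineOf (φ ᵥ* A.1) ⊆ F := by
  intro p hp
  obtain ⟨v, hv, rfl⟩ := exists_pt p
  rw [pt_mem_lineOf hv, ← dotProduct_mulVec] at hp
  have h1 : (A : PSL(3, ℂ)) • pt v ∈ F := by
    rw [smul_pt _ hv]
    exact hφ ((pt_mem_lineOf (mulVec_ne_zero _ hv)).2 hp)
  simpa using hinv _ (Γ.inv_mem hA) _ h1

/-- A closed invariant set which contains the line of covector `φ` contains its limits under the
inverses of a degenerating sequence. -/
theorem lineOf_vecMul_subset {Γ : Subgroup PSL(3, ℂ)} {F : Set P2} (hF : IsClosed F)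
    (hinv : ∀ γ ∈ Γ, ∀ x ∈ F, γ • x ∈ F) {γ : ℕ → PSL(3, ℂ)} (hγ : ∀ n, γ n ∈ Γ)
    {M M' : Matrix (Fin 3) (Fin 3) ℂ} (hdeg : Degenerates γ M M') {φ : Fin 3 → ℂ}
    (hφ : lineOf φ ⊆ F) (hφM : φ ᵥ* M ≠ 0) : lineOf (φ ᵥ* M) ⊆ F := by
  obtain ⟨-, -, A, a, b, hA, ha, hb, ha0, hb0, hlim, hlim'⟩ := hdeg
  refine lineOf_subset_of_tendsto hF hφM (tendsto_vecMul hlim φ) fun n => ?_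
  rw [vecMul_smul, lineOf_smul (ha n)]
  exact lineOf_vecMul_subset_of_mem hinv (by rw [hA]; exact hγ n) hφ

/-- A closed invariant set which contains three lines in general position also contains a line
through each point of the kernels of the limits of sequences of the group. -/
theorem ContainsTriangle.exists_lineOf_subset {Γ : Subgroup PSL(3, ℂ)} {F : Set P2}
    (htri : ContainsTriangle F) (hF : IsClosed F) (hinv : ∀ γ ∈ Γ, ∀ x ∈ F, γ • x ∈ F)
    {γ : ℕ → PSL(3, ℂ)} (hγ : ∀ n, γ n ∈ Γ) {M M' : Matrix (Fin 3) (Fin 3) ℂ}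
    (hdeg : Degenerates γ M M') {v : Fin 3 → ℂ} (hv : v ≠ 0) (hMv : M *ᵥ v = 0) :
    ∃ ψ : Fin 3 → ℂ, ψ ≠ 0 ∧ pt v ∈ lineOf ψ ∧ lineOf ψ ⊆ F := by
  obtain ⟨Φ, hΦ, hΦF⟩ := htri
  obtain ⟨w, hw⟩ := exists_mulVec_ne_zero hdeg.1
  -- one of the three lines misses a point of the image of `M`
  obtain ⟨i, hi⟩ : ∃ i, Φ i ⬝ᵥ (M *ᵥ w) ≠ 0 := by
    by_contra hc
    push Not at hc
    exact hw (hΦ _ hc)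
  have hne : Φ i ᵥ* M ≠ 0 := by
    intro h0
    rw [dotProduct_mulVec, h0, zero_dotProduct] at hi
    exact hi rfl
  refine ⟨Φ i ᵥ* M, hne, ?_, lineOf_vecMul_subset hF hinv hγ hdeg (hΦF i) hne⟩
  rw [pt_mem_lineOf hv, ← dotProduct_mulVec, hMv, dotProduct_zero]

/-- The complement of a closed invariant set which contains three lines in general position is
contained in the equicontinuity set. -/
theorem compl_subset_equicontinuitySet {Γ : Subgroup PSL(3, ℂ)} (hΓ : DiscreteTopology Γ)
    {F : Set P2} (htri : ContainsTriangle F) (hF : IsClosed F)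
    (hinv : ∀ γ ∈ Γ, ∀ x ∈ F, γ • x ∈ F) : Fᶜ ⊆ equicontinuitySet (Γ : Set PSL(3, ℂ)) := by
  refine fun z hz => ⟨Fᶜ, hF.isOpen_compl, hz,
    isNormalFamilyOn_of_forall_mulVec_ne_zero hΓ fun γ M M' hγ hdeg v hv hvF hMv => ?_⟩
  obtain ⟨ψ, -, hvψ, hψF⟩ := htri.exists_lineOf_subset hF hinv hγ hdeg hv hMv
  exact hvF (hψF hvψ)

theorem smul_mem_compl_equicontinuitySet {Γ : Subgroup PSL(3, ℂ)} :
    ∀ γ ∈ Γ, ∀ x ∈ (equicontinuitySet (Γ : Set PSL(3, ℂ)))ᶜ,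
      γ • x ∈ (equicontinuitySet (Γ : Set PSL(3, ℂ)))ᶜ := fun γ hγ x hx h =>
  hx (by simpa using smul_mem_equicontinuitySet (Γ.inv_mem hγ) h)

theorem isUnionOfComplexLines_compl_equicontinuitySet {Γ : Subgroup PSL(3, ℂ)}
    (hΓ : DiscreteTopology Γ)
    (htri : ContainsTriangle (equicontinuitySet (Γ : Set PSL(3, ℂ)))ᶜ) :
    IsUnionOfComplexLines (equicontinuitySet (Γ : Set PSL(3, ℂ)))ᶜ := by
  set F := (equicontinuitySet (Γ : Set PSL(3, ℂ)))ᶜ with hFdef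
  have hF : IsClosed F := (isOpen_equicontinuitySet _).isClosed_compl
  refine ⟨{l | IsComplexLine l ∧ l ⊆ F}, fun l hl => hl.1, ?_⟩
  refine Subset.antisymm (fun z hz => ?_) (sUnion_subset fun l hl => hl.2)
  obtain ⟨v, hv, rfl⟩ := exists_pt z
  -- arbitrarily close to the point there are kernels, hence lines contained in `F`
  have hex : ∀ n : ℕ, ∃ u ψ : Fin 3 → ℂ, dist u v < 1 / ((n : ℝ) + 1) ∧ u ≠ 0 ∧ ψ ≠ 0 ∧
      ψ ⬝ᵥ u = 0 ∧ lineOf ψ ⊆ F := by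
    intro n
    have hball : Metric.ball v (1 / ((n : ℝ) + 1)) ∈ 𝓝 v :=
      Metric.ball_mem_nhds v Nat.one_div_pos_of_nat
    by_contra hc
    push Not at hc
    refine hz ⟨interior (pt '' (Metric.ball v (1 / ((n : ℝ) + 1)) \ {0})), isOpen_interior,
      mem_interior_iff_mem_nhds.2 (image_pt_mem_nhds hv hball),
      isNormalFamilyOn_of_forall_mulVec_ne_zero hΓ fun γ M M' hγ hdeg u hu hmem hMu => ?_⟩
    obtain ⟨y, ⟨hy, hy0⟩, hyu⟩ := interior_subset hmem
    obtain ⟨ψ, hψ, huψ, hψF⟩ := htri.exists_lineOf_subset hF smul_mem_compl_equicontinuitySet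
      hγ hdeg hu hMu
    rw [← hyu, pt_mem_lineOf hy0] at huψ
    exact hc y ψ hy hy0 hψ huψ hψF
  choose u ψ hu hu0 hψ hψu hψF using hex
  obtain ⟨φ, hφ, χ, hχ, hlim⟩ := exists_subseq_tendsto_normalized ψ hψ
  have hulim : Tendsto u atTop (𝓝 v) := by
    rw [tendsto_iff_dist_tendsto_zero]
    exact squeeze_zero (fun _ => dist_nonneg) (fun n => (hu n).le)
      tendsto_one_div_add_atTop_nhds_zero_nat
  have hχv : χ ⬝ᵥ v = 0 := by
    refine tendsto_nhds_unique (tendsto_dotProduct hlim (hulim.comp hφ.tendsto_atTop)) ?_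
    refine tendsto_const_nhds.congr fun n => ?_
    rw [smul_dotProduct, Function.comp, hψu, smul_zero]
  refine mem_sUnion.2 ⟨lineOf χ, ⟨isComplexLine_lineOf hχ,
    lineOf_subset_of_tendsto hF hχ hlim fun n => ?_⟩, (pt_mem_lineOf hv).2 hχv⟩
  rw [lineOf_smul (by simpa using hψ (φ n))]
  exact hψF _

/-! ### Invariance of the limit sets -/

section Conjugation

variable {G G' : Subgroup PSL(3, ℂ)} {h : PSL(3, ℂ)}

theorem smul_mem_L0 (hG : ∀ γ, γ ∈ G ↔ h * γ * h⁻¹ ∈ G') {x : P2} (hx : x ∈ L0 G) :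
    h • x ∈ L0 G' := by
  refine map_mem_closure (continuous_const_smul h) hx fun z hz => ?_
  refine (hz.image (f := fun γ => h * γ * h⁻¹) (fun a _ b _ hab => by simpa using hab)).mono ?_
  rintro _ ⟨γ, ⟨hγ, hγz⟩, rfl⟩
  refine ⟨(hG γ).1 hγ, ?_⟩
  simp only [mul_smul, inv_smul_smul, hγz]

theorem mem_iff_conj_mem_symm (hG : ∀ γ, γ ∈ G ↔ h * γ * h⁻¹ ∈ G') :
    ∀ γ, γ ∈ G' ↔ h⁻¹ * γ * h⁻¹⁻¹ ∈ G := fun γ => by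
  rw [hG]
  simp [mul_assoc]

theorem smul_mem_L0_iff (hG : ∀ γ, γ ∈ G ↔ h * γ * h⁻¹ ∈ G') {x : P2} :
    h • x ∈ L0 G' ↔ x ∈ L0 G :=
  ⟨fun hx => by simpa using smul_mem_L0 (mem_iff_conj_mem_symm hG) hx, smul_mem_L0 hG⟩

theorem smul_mem_clusterPoints (hG : ∀ γ, γ ∈ G ↔ h * γ * h⁻¹ ∈ G') {K : Set P2} {x : P2}
    (hx : x ∈ clusterPoints G K) : h • x ∈ clusterPoints G' ((fun y => h • y) '' K) := by
  obtain ⟨k, γ, hk, hγ, hinj, hlim⟩ := hx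
  refine ⟨fun n => h • k n, fun n => h * γ n * h⁻¹, fun n => ⟨_, hk n, rfl⟩,
    fun n => (hG _).1 (hγ n), fun m n hmn => hinj (by simpa using hmn), ?_⟩
  refine (hlim.const_smul h).congr fun n => ?_
  simp only [mul_smul, inv_smul_smul]

theorem smul_mem_L1 (hG : ∀ γ, γ ∈ G ↔ h * γ * h⁻¹ ∈ G') {x : P2} (hx : x ∈ L1 G) :
    h • x ∈ L1 G' := by
  refine map_mem_closure (continuous_const_smul h) hx fun q hq => ?_
  obtain ⟨z, hz, hq⟩ := mem_iUnion₂.1 hq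
  refine mem_iUnion₂.2 ⟨h • z, fun hc => hz ((smul_mem_L0_iff hG).1 hc), ?_⟩
  simpa using smul_mem_clusterPoints hG hq

theorem smul_mem_L1_iff (hG : ∀ γ, γ ∈ G ↔ h * γ * h⁻¹ ∈ G') {x : P2} :
    h • x ∈ L1 G' ↔ x ∈ L1 G :=
  ⟨fun hx => by simpa using smul_mem_L1 (mem_iff_conj_mem_symm hG) hx, smul_mem_L1 hG⟩

theorem smul_mem_L2 (hG : ∀ γ, γ ∈ G ↔ h * γ * h⁻¹ ∈ G') {x : P2} (hx : x ∈ L2 G) :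
    h • x ∈ L2 G' := by
  refine map_mem_closure (continuous_const_smul h) hx fun q hq => ?_
  obtain ⟨K, hK, hKL, hq⟩ := hq
  refine ⟨_, hK.image (continuous_const_smul h), ?_, smul_mem_clusterPoints hG hq⟩
  rintro _ ⟨z, hz, rfl⟩ (hc | hc)
  · exact hKL hz (Or.inl ((smul_mem_L0_iff hG).1 hc))
  · exact hKL hz (Or.inr ((smul_mem_L1_iff hG).1 hc))

theorem smul_mem_limitSet (hG : ∀ γ, γ ∈ G ↔ h * γ * h⁻¹ ∈ G') {x : P2} (hx : x ∈ limitSet G) :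
    h • x ∈ limitSet G' := by
  rcases hx with (hx | hx) | hx
  · exact Or.inl (Or.inl (smul_mem_L0 hG hx))
  · exact Or.inl (Or.inr (smul_mem_L1 hG hx))
  · exact Or.inr (smul_mem_L2 hG hx)

end Conjugation

theorem smul_mem_limitSet_of_mem {Γ : Subgroup PSL(3, ℂ)} :
    ∀ γ ∈ Γ, ∀ x ∈ limitSet Γ, γ • x ∈ limitSet Γ := fun h hh x hx =>
  smul_mem_limitSet (fun γ => by
    rw [Γ.mul_mem_cancel_right (Γ.inv_mem hh), Γ.mul_mem_cancel_left hh]) hx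

theorem smul_mem_cyclicLimitSet {Γ : Subgroup PSL(3, ℂ)} :
    ∀ γ ∈ Γ, ∀ x ∈ cyclicLimitSet Γ, γ • x ∈ cyclicLimitSet Γ := fun h hh x hx => by
  refine map_mem_closure (continuous_const_smul h) hx fun z hz => ?_
  obtain ⟨γ, hγ, hz⟩ := mem_iUnion₂.1 hz
  refine mem_iUnion₂.2 ⟨h * γ * h⁻¹, Γ.mul_mem (Γ.mul_mem hh hγ) (Γ.inv_mem hh), ?_⟩
  refine smul_mem_limitSet (fun δ => ?_) hz
  simp only [Subgroup.mem_zpowers_iff, conj_zpow]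
  simp

theorem isClosed_limitSet (Γ : Subgroup PSL(3, ℂ)) : IsClosed (limitSet Γ) :=
  (isClosed_closure.union isClosed_closure).union isClosed_closure

theorem discontinuityRegion_eq_equicontinuitySet {Γ : Subgroup PSL(3, ℂ)}
    (hΓ : DiscreteTopology Γ) (h : ContainsTriangle (limitSet Γ)) :
    discontinuityRegion Γ = equicontinuitySet (Γ : Set PSL(3, ℂ)) :=
  Subset.antisymm (compl_subset_equicontinuitySet hΓ h (isClosed_limitSet Γ)
    smul_mem_limitSet_of_mem) (equicontinuitySet_subset_discontinuityRegion hΓ)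

theorem cyclicLimitSet_eq_compl_equicontinuitySet {Γ : Subgroup PSL(3, ℂ)}
    (hΓ : DiscreteTopology Γ) (h : ContainsTriangle (cyclicLimitSet Γ)) :
    cyclicLimitSet Γ = (equicontinuitySet (Γ : Set PSL(3, ℂ)))ᶜ := by
  refine Subset.antisymm ?_ (compl_subset_comm.1
    (compl_subset_equicontinuitySet hΓ h isClosed_closure smul_mem_cyclicLimitSet))
  refine closure_minimal (iUnion₂_subset fun γ hγ x hx hxE => ?_)
    (isOpen_equicontinuitySet _).isClosed_compl
  have hle : (Subgroup.zpowers γ : Set PSL(3, ℂ)) ⊆ Γ :=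
    (Subgroup.zpowers_le (H := Γ)).2 hγ
  have hd : DiscreteTopology (Subgroup.zpowers γ) := DiscreteTopology.of_subset hΓ hle
  exact equicontinuitySet_subset_discontinuityRegion hd (equicontinuitySet_anti hle hxE) hx

/-! ### Linear algebra in dimension three -/

theorem exists_smul_eq_of_crossProduct_eq_zero {x y : Fin 3 → ℂ} (hx : x ≠ 0)
    (h : x ⨯₃ y = 0) : ∃ c : ℂ, y = c • x := by
  by_contra hc
  push Not at hc
  refine (crossProduct_ne_zero_iff_linearIndependent (v := x) (w := y)).2 ?_ h
  exact (LinearIndependent.pair_iff' hx).2 fun a => (hc a).symm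

theorem exists_eq_add_of_crossProduct_dotProduct_eq_zero {x y z : Fin 3 → ℂ} (hxy : x ⨯₃ y ≠ 0)
    (h : (x ⨯₃ y) ⬝ᵥ z = 0) : ∃ a b : ℂ, z = a • x + b • y := by
  rw [dotProduct_comm, triple_product_eq_det] at h
  obtain ⟨c, hc, hc0⟩ := exists_vecMul_eq_zero_iff.2 h
  have hsum : c 0 • z + c 1 • x + c 2 • y = 0 := by
    rw [← hc0]
    ext i
    simp [vecMul, dotProduct, Fin.sum_univ_three]
  have h0 : c 0 ≠ 0 := by
    intro h0
    rw [h0, zero_smul, zero_add] at hsum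
    have h1 := congrArg (fun t => x ⨯₃ t) hsum
    have h2 := congrArg (fun t => t ⨯₃ y) hsum
    simp only [map_add, map_smul, cross_self, smul_zero, zero_add, map_zero, smul_eq_zero, hxy,
      or_false, LinearMap.add_apply, LinearMap.smul_apply, add_zero, LinearMap.zero_apply] at h1 h2
    refine hc (funext fun i => ?_)
    fin_cases i <;> assumption
  refine ⟨-(c 1 / c 0), -(c 2 / c 0), ?_⟩
  have h3 : z = (c 0)⁻¹ • (c 0 • z) := by rw [smul_smul, inv_mul_cancel₀ h0, one_smul]
  have h4 : c 0 • z = -(c 1 • x + c 2 • y) := by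
    rw [eq_neg_iff_add_eq_zero, ← add_assoc, hsum]
  rw [h3, h4]
  ext i
  simp only [Pi.smul_apply, Pi.neg_apply, Pi.add_apply, smul_eq_mul]
  field_simp
  ring

theorem exists_smul_crossProduct_of_dotProduct_eq_zero {φ ψ v : Fin 3 → ℂ} (h : φ ⨯₃ ψ ≠ 0)
    (hφ : φ ⬝ᵥ v = 0) (hψ : ψ ⬝ᵥ v = 0) : ∃ c : ℂ, v = c • (φ ⨯₃ ψ) := by
  apply exists_smul_eq_of_crossProduct_eq_zero h
  rw [cross_cross_eq_smul_sub_smul, hφ, hψ]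
  simp

theorem exists_dotProduct_eq_zero_notMem_span {φ x : Fin 3 → ℂ} (hφ : φ ≠ 0) :
    ∃ y : Fin 3 → ℂ, φ ⬝ᵥ y = 0 ∧ ∀ c : ℂ, y ≠ c • x := by
  by_contra hc
  push Not at hc
  have hle : LinearMap.ker (dotProductBilin ℂ ℂ φ : (Fin 3 → ℂ) →ₗ[ℂ] ℂ) ≤
      Submodule.span ℂ {x} := by
    intro y hy
    obtain ⟨c, rfl⟩ := hc y (by simpa using hy)
    exact Submodule.smul_mem _ _ (Submodule.mem_span_singleton_self x)
  have h1 := Submodule.finrank_mono hle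
  have h2 := finrank_span_le_card (R := ℂ) ({x} : Set (Fin 3 → ℂ))
  rw [finrank_ker_dotProduct hφ] at h1
  simp at h2
  omega

theorem eq_vecMulVec_of_forall {M : Matrix (Fin 3) (Fin 3) ℂ} {x : Fin 3 → ℂ}
    (h : ∀ z : Fin 3 → ℂ, ∃ c : ℂ, M *ᵥ z = c • x) : ∃ φ : Fin 3 → ℂ, M = vecMulVec x φ := by
  choose c hc using fun j : Fin 3 => h (Pi.single j 1)
  refine ⟨c, Matrix.ext fun i j => ?_⟩
  have := congrFun (hc j) i
  simpa [vecMulVec_apply, mul_comm] using this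

theorem vecMulVec_mulVec_eq (u φ z : Fin 3 → ℂ) : vecMulVec u φ *ᵥ z = (φ ⬝ᵥ z) • u := by
  ext i
  simp [vecMulVec_mulVec, mul_comm]

theorem eq_zero_of_forall_mulVec {M : Matrix (Fin 3) (Fin 3) ℂ} {χ f : Fin 3 → ℂ}
    (hf : χ ⬝ᵥ f ≠ 0) (hMf : M *ᵥ f = 0) (h : ∀ w : Fin 3 → ℂ, χ ⬝ᵥ w = 0 → M *ᵥ w = 0) :
    M = 0 := by
  by_contra hM
  obtain ⟨z, hz⟩ := exists_mulVec_ne_zero hM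
  have h1 := h (z - ((χ ⬝ᵥ z) / (χ ⬝ᵥ f)) • f) (by
    rw [dotProduct_sub, dotProduct_smul, smul_eq_mul, div_mul_cancel₀ _ hf, sub_self])
  rw [mulVec_sub, mulVec_smul, hMf, smul_zero, sub_zero] at h1
  exact hz h1

/-- If two nonzero matrices annihilate each other, one of them has rank one. -/
theorem exists_vecMulVec_of_mul_eq_zero {M M' : Matrix (Fin 3) (Fin 3) ℂ} (h : M * M' = 0)
    (hM : M ≠ 0) (hM' : M' ≠ 0) :
    (∃ u φ, M = vecMulVec u φ) ∨ ∃ u φ, M' = vecMulVec u φ := by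
  have key : ∀ X : Matrix (Fin 3) (Fin 3) ℂ, X ≠ 0 → X.rank ≤ 1 → ∃ u φ, X = vecMulVec u φ := by
    intro X hX hr
    obtain ⟨w, hw⟩ := exists_mulVec_ne_zero hX
    refine ⟨X *ᵥ w, eq_vecMulVec_of_forall fun z => ?_⟩
    have hfr : Module.finrank ℂ (LinearMap.range X.mulVecLin) ≤ 1 := hr
    obtain ⟨y, hy⟩ := finrank_le_one_iff.1 hfr
    obtain ⟨a, ha⟩ := hy ⟨X *ᵥ w, w, rfl⟩
    obtain ⟨b, hb⟩ := hy ⟨X *ᵥ z, z, rfl⟩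
    replace ha : a • y.1 = X *ᵥ w := congrArg Subtype.val ha
    replace hb : b • y.1 = X *ᵥ z := congrArg Subtype.val hb
    have ha0 : a ≠ 0 := by
      rintro rfl
      exact hw (by rw [← ha, zero_smul])
    refine ⟨b / a, ?_⟩
    rw [← ha, ← hb, smul_smul, div_mul_cancel₀ _ ha0]
  have hrank := rank_add_rank_le_card_of_mul_eq_zero h
  rw [Fintype.card_fin] at hrank
  by_cases hr : M.rank ≤ 1
  · exact Or.inl (key M hM hr)
  · exact Or.inr (key M' hM' (by omega))

/-! ### Open sets with a proper action -/

theorem ActsProperlyDiscontinuouslyOn.notMem_of_tendsto {Γ : Subgroup PSL(3, ℂ)} {U : Set P2}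
    (hU : ActsProperlyDiscontinuouslyOn Γ U) (hUo : IsOpen U) {γ : ℕ → PSL(3, ℂ)}
    (hγ : ∀ n, γ n ∈ Γ) (hcof : Tendsto γ atTop cofinite) {x : ℕ → P2} {p q : P2}
    (hx : Tendsto x atTop (𝓝 p)) (hγx : Tendsto (fun n => γ n • x n) atTop (𝓝 q)) (hp : p ∈ U) :
    q ∉ U := by
  intro hq
  obtain ⟨K, hK, hpK, hKU⟩ := exists_compact_subset hUo hp
  obtain ⟨K', hK', hqK', hKU'⟩ := exists_compact_subset hUo hq
  have hfin := hU.2 _ (hK.union hK') (union_subset hKU hKU')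
  obtain ⟨n, hn⟩ := ((hx.eventually (isOpen_interior.mem_nhds hpK)).and
    ((hγx.eventually (isOpen_interior.mem_nhds hqK')).and
    (hcof.eventually hfin.eventually_cofinite_notMem))).exists
  exact hn.2.2 ⟨hγ n, _, ⟨x n, Or.inl (interior_subset hn.1), rfl⟩,
    Or.inr (interior_subset hn.2.1)⟩

/-- For a degenerating sequence `γ`, every point `x` of the kernel of `M` is dynamically related
to every point `y`, other than `M w`, of the limit of the images of the line through `x` and
`w`. -/
theorem Degenerates.exists_tendsto_of_mulVec_eq_zero {γ : ℕ → PSL(3, ℂ)}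
    {M M' : Matrix (Fin 3) (Fin 3) ℂ} (hdeg : Degenerates γ M M') {x w y : Fin 3 → ℂ} (hx : x ≠ 0)
    (hMx : M *ᵥ x = 0) (hMw : M *ᵥ w ≠ 0) (hψ : (x ⨯₃ w) ᵥ* M' ≠ 0) (hy : y ≠ 0)
    (hψy : ((x ⨯₃ w) ᵥ* M') ⬝ᵥ y = 0) (hne : pt y ≠ pt (M *ᵥ w)) :
    ∃ (φ : ℕ → ℕ) (s : ℕ → P2), StrictMono φ ∧ Tendsto s atTop (𝓝 (pt x)) ∧
      Tendsto (fun n => γ (φ n) • s n) atTop (𝓝 (pt y)) := by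
  have hxw : x ⨯₃ w ≠ 0 := by
    intro h0
    rw [h0, zero_vecMul] at hψ
    exact hψ rfl
  have hdeg' := hdeg
  obtain ⟨-, -, A, a, b, hA, ha, hb, -, -, -, hlim'⟩ := hdeg
  obtain ⟨z, hz⟩ := exists_dotProduct_ne_zero hψ
  rw [dotProduct_comm] at hz
  -- `y n` tends to `y` on the image of the line through `x` and `w`
  obtain ⟨t, ht, hzero⟩ :=
    exists_tendsto_zero_dotProduct_eq_zero (tendsto_vecMul hlim' (x ⨯₃ w)) hψy hz
  have hylim : Tendsto (fun n => y + t n • z) atTop (𝓝 y) := by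
    simpa using (ht.smul_const z).const_add y
  have hylim' : Tendsto (fun n => pt (y + t n • z)) atTop (𝓝 (pt y)) := tendsto_pt hy hylim
  have hγs : ∀ n, γ n • ((γ n)⁻¹ • pt (y + t n • z)) = pt (y + t n • z) := fun n => by simp
  obtain ⟨φ, s, v, hφ, hv, hs, hsφ, hslim⟩ :=
    exists_subseq_lift fun n => (γ n)⁻¹ • pt (y + t n • z)
  have hvlim := tendsto_pt hv hslim
  simp only [hsφ] at hvlim
  have hγlim : Tendsto (fun n => γ (φ n) • ((γ (φ n))⁻¹ • pt (y + t (φ n) • z))) atTop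
      (𝓝 (pt y)) := by
    simp only [hγs]
    exact hylim'.comp hφ.tendsto_atTop
  refine ⟨φ, fun n => (γ (φ n))⁻¹ • pt (y + t (φ n) • z), hφ, ?_, hγlim⟩
  have hvperp : (x ⨯₃ w) ⬝ᵥ v = 0 := by
    refine tendsto_nhds_unique (tendsto_dotProduct (tendsto_const_nhds (x := x ⨯₃ w)) hslim) ?_
    refine tendsto_const_nhds.congr' ?_
    filter_upwards [hφ.tendsto_atTop.eventually hzero,
      hφ.tendsto_atTop.eventually (hylim.eventually_ne hy)] with n hn hn0
    have h1 : pt (s n) = pt ((A (φ n))⁻¹.1 *ᵥ (y + t (φ n) • z)) := by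
      rw [hsφ n, ← smul_pt _ hn0, QuotientGroup.mk_inv, hA]
    obtain ⟨c, hc⟩ := (pt_eq_pt_iff (hs n) (mulVec_ne_zero _ hn0)).1 h1
    rw [← dotProduct_mulVec, smul_mulVec, dotProduct_smul, smul_eq_zero] at hn
    rw [← hc, dotProduct_smul, hn.resolve_left (hb _), smul_zero]
  obtain ⟨α, β, rfl⟩ := exists_eq_add_of_crossProduct_dotProduct_eq_zero hxw hvperp
  by_cases hβ : β = 0
  · subst hβ
    rw [zero_smul, add_zero] at hvlim hv
    have hα : α ≠ 0 := by
      rintro rfl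
      exact hv (zero_smul _ _)
    rwa [pt_smul hα hx] at hvlim
  · -- off the kernel of `M` the sequence would converge to `M w`
    have hMv : M *ᵥ (α • x + β • w) = β • (M *ᵥ w) := by
      rw [mulVec_add, mulVec_smul, mulVec_smul, hMx, smul_zero, zero_add]
    have h1 := (hdeg'.comp hφ).tendsto_smul
      (by rw [hMv]; exact smul_ne_zero hβ hMw) hvlim
    rw [hMv, pt_smul hβ hMw] at h1
    exact absurd (tendsto_nhds_unique hγlim h1) hne

theorem exists_pt_mem_dotProduct_ne_zero {U : Set P2} (hU : IsOpen U) (hne : U.Nonempty)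
    {φ : Fin 3 → ℂ} (hφ : φ ≠ 0) : ∃ w : Fin 3 → ℂ, pt w ∈ U ∧ φ ⬝ᵥ w ≠ 0 := by
  by_contra hc
  push Not at hc
  obtain ⟨p, hp⟩ := hne
  obtain ⟨v, hv, rfl⟩ := exists_pt p
  obtain ⟨z, hz⟩ := exists_dotProduct_ne_zero hφ
  rw [dotProduct_comm] at hz
  have hcont : ContinuousAt (fun t : ℂ => pt (v + t • z)) 0 :=
    ContinuousAt.comp (g := pt) (f := fun t : ℂ => v + t • z)
      (by simpa using continuousAt_pt hv) (by fun_prop)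
  have hev : ∀ᶠ t in 𝓝[≠] (0 : ℂ), pt (v + t • z) ∈ U :=
    (hcont.eventually_mem (hU.mem_nhds (by simpa using hp))).filter_mono nhdsWithin_le_nhds
  obtain ⟨t, ht, ht0⟩ := (hev.and self_mem_nhdsWithin).exists
  have h1 := hc _ ht
  rw [dotProduct_add, hc v hp, dotProduct_smul, zero_add, smul_eq_zero] at h1
  exact h1.elim ht0 hz

section ProperAction

variable {Γ : Subgroup PSL(3, ℂ)} {U : Set P2} {γ : ℕ → PSL(3, ℂ)}
  {M M' : Matrix (Fin 3) (Fin 3) ℂ} {u φ x w : Fin 3 → ℂ}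

theorem ActsProperlyDiscontinuouslyOn.pt_notMem
    (hU : ActsProperlyDiscontinuouslyOn Γ U) (hUo : IsOpen U) (hγ : ∀ n, γ n ∈ Γ)
    (hdeg : Degenerates γ M M') (hne : U.Nonempty) (hM : M = vecMulVec u φ) :
    pt u ∉ U := by
  have hφ : φ ≠ 0 := by
    rintro rfl
    exact hdeg.1 (by simp [hM])
  have hu : u ≠ 0 := by
    rintro rfl
    exact hdeg.1 (by simp [hM])
  obtain ⟨w, hwU, hw⟩ := exists_pt_mem_dotProduct_ne_zero hUo hne hφ
  have hMw : M *ᵥ w = (φ ⬝ᵥ w) • u := by rw [hM, vecMulVec_mulVec_eq]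
  have h1 := hdeg.tendsto_smul (by rw [hMw]; exact smul_ne_zero hw hu)
    (tendsto_const_nhds (x := pt w))
  rw [hMw, pt_smul hw hu] at h1
  exact hU.notMem_of_tendsto hUo hγ hdeg.tendsto_cofinite tendsto_const_nhds h1 hwU

theorem Degenerates.eq_vecMulVec_of_vecMul_eq_zero
    (hdeg : Degenerates γ M M') (hM : M = vecMulVec u φ) (hx : x ≠ 0)
    (hφx : φ ⬝ᵥ x = 0) (hφw : φ ⬝ᵥ w ≠ 0) (h0 : (x ⨯₃ w) ᵥ* M' = 0) :
    ∃ φ', M' = vecMulVec x φ' := by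
  have hu : u ≠ 0 := by
    rintro rfl
    exact hdeg.1 (by simp [hM])
  have hxw : x ⨯₃ w ≠ 0 := by
    intro hxw
    obtain ⟨c, hc⟩ := exists_smul_eq_of_crossProduct_eq_zero hx hxw
    exact hφw (by rw [hc, dotProduct_smul, hφx, smul_zero])
  refine eq_vecMulVec_of_forall fun z => ?_
  obtain ⟨α, β, hz⟩ := exists_eq_add_of_crossProduct_dotProduct_eq_zero (z := M' *ᵥ z) hxw
    (by rw [dotProduct_mulVec, h0, zero_dotProduct])
  have h1 : M *ᵥ (M' *ᵥ z) = 0 := by rw [mulVec_mulVec, hdeg.mul_eq_zero, zero_mulVec]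
  rw [hM, vecMulVec_mulVec_eq, smul_eq_zero, or_iff_left hu, hz, dotProduct_add,
    dotProduct_smul, hφx, dotProduct_smul, smul_zero, zero_add, smul_eq_zero,
    or_iff_left hφw] at h1
  exact ⟨α, by rw [hz, h1, zero_smul, add_zero]⟩

/-- If the limit `M` has rank one and the region `U` of proper discontinuity meets the line of
its kernel at `x`, then the complement of `U` contains the whole line of the points which are
mapped to `x` by `M'`. -/
theorem ActsProperlyDiscontinuouslyOn.lineOf_subset_compl
    (hU : ActsProperlyDiscontinuouslyOn Γ U) (hUo : IsOpen U) (hγ : ∀ n, γ n ∈ Γ)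
    (hdeg : Degenerates γ M M') (hM : M = vecMulVec u φ) (hx : x ≠ 0)
    (hxU : pt x ∈ U) (hφx : φ ⬝ᵥ x = 0) (hφw : φ ⬝ᵥ w ≠ 0) :
    (x ⨯₃ w) ᵥ* M' ≠ 0 ∧ lineOf ((x ⨯₃ w) ᵥ* M') ⊆ Uᶜ := by
  have hu : u ≠ 0 := by
    rintro rfl
    exact hdeg.1 (by simp [hM])
  have hψ : (x ⨯₃ w) ᵥ* M' ≠ 0 := by
    intro h0
    obtain ⟨φ', hM'⟩ := hdeg.eq_vecMulVec_of_vecMul_eq_zero hM hx hφx hφw h0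
    exact hU.pt_notMem hUo (fun n => Γ.inv_mem (hγ n)) hdeg.inv ⟨_, hxU⟩ hM' hxU
  refine ⟨hψ, fun p hp hpU => ?_⟩
  obtain ⟨y, hy, rfl⟩ := exists_pt p
  rw [pt_mem_lineOf hy] at hp
  have hMw : M *ᵥ w = (φ ⬝ᵥ w) • u := by rw [hM, vecMulVec_mulVec_eq]
  by_cases hyu : pt y = pt (M *ᵥ w)
  · rw [hyu, hMw, pt_smul hφw hu] at hpU
    exact hU.pt_notMem hUo hγ hdeg ⟨_, hxU⟩ hM hpU
  · obtain ⟨θ, s, hθ, hs, hγs⟩ := hdeg.exists_tendsto_of_mulVec_eq_zero hx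
      (by rw [hM, vecMulVec_mulVec_eq, hφx, zero_smul])
      (by rw [hMw]; exact smul_ne_zero hφw hu) hψ hy hp hyu
    exact hU.notMem_of_tendsto hUo (fun n => hγ (θ n)) (hdeg.comp hθ).tendsto_cofinite hs hγs
      hxU hpU

end ProperAction

section ProperAction

variable {Γ : Subgroup PSL(3, ℂ)} {U : Set P2}

/-- The complement of a nonempty region of proper discontinuity contains a line. -/
theorem ActsProperlyDiscontinuouslyOn.exists_lineOf_subset_compl
    (hU : ActsProperlyDiscontinuouslyOn Γ U) (hUo : IsOpen U)
    {γ : ℕ → PSL(3, ℂ)} (hγ : ∀ n, γ n ∈ Γ) {M M' : Matrix (Fin 3) (Fin 3) ℂ}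
    (hdeg : Degenerates γ M M') : ∃ χ : Fin 3 → ℂ, χ ≠ 0 ∧ lineOf χ ⊆ Uᶜ := by
  -- up to passing to the inverses, the limit has rank one
  have key : ∀ (γ : ℕ → PSL(3, ℂ)) (M M' : Matrix (Fin 3) (Fin 3) ℂ), (∀ n, γ n ∈ Γ) →
      Degenerates γ M M' → (∃ u φ, M = vecMulVec u φ) →
      ∃ χ : Fin 3 → ℂ, χ ≠ 0 ∧ lineOf χ ⊆ Uᶜ := by
    rintro γ M M' hγ hdeg ⟨u, φ, hM⟩
    have hφ : φ ≠ 0 := by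
      rintro rfl
      exact hdeg.1 (by simp [hM])
    by_cases hsub : lineOf φ ⊆ Uᶜ
    · exact ⟨φ, hφ, hsub⟩
    · obtain ⟨p, hp, hpU⟩ := not_subset.1 hsub
      obtain ⟨x, hx, rfl⟩ := exists_pt p
      obtain ⟨w, hw⟩ := exists_dotProduct_ne_zero hφ
      rw [dotProduct_comm] at hw
      exact ⟨_, hU.lineOf_subset_compl hUo hγ hdeg hM hx (not_not.1 hpU)
        ((pt_mem_lineOf hx).1 hp) hw⟩
  rcases exists_vecMulVec_of_mul_eq_zero hdeg.mul_eq_zero hdeg.1 hdeg.2.1 with h | h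
  · exact key γ M M' hγ hdeg h
  · exact key _ M' M (fun n => Γ.inv_mem (hγ n)) hdeg.inv h

/-- If the complement of a region of proper discontinuity contains only one line, then this line
is the kernel of one of the two limits of every degenerating sequence. -/
theorem ActsProperlyDiscontinuouslyOn.mulVec_eq_zero_or
    (hU : ActsProperlyDiscontinuouslyOn Γ U) (hUo : IsOpen U) {χ : Fin 3 → ℂ}
    (huniq : ∀ ψ : Fin 3 → ℂ, ψ ≠ 0 → lineOf ψ ⊆ Uᶜ → ∃ c : ℂ, ψ = c • χ)
    {γ : ℕ → PSL(3, ℂ)} (hγ : ∀ n, γ n ∈ Γ) {M M' : Matrix (Fin 3) (Fin 3) ℂ}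
    (hdeg : Degenerates γ M M') :
    (∀ w, χ ⬝ᵥ w = 0 → M *ᵥ w = 0) ∨ ∀ w, χ ⬝ᵥ w = 0 → M' *ᵥ w = 0 := by
  have key : ∀ (γ : ℕ → PSL(3, ℂ)) (M M' : Matrix (Fin 3) (Fin 3) ℂ), (∀ n, γ n ∈ Γ) →
      Degenerates γ M M' → (∃ u φ, M = vecMulVec u φ) →
      (∀ w, χ ⬝ᵥ w = 0 → M *ᵥ w = 0) ∨ ∀ w, χ ⬝ᵥ w = 0 → M' *ᵥ w = 0 := by
    rintro γ M M' hγ hdeg ⟨u, φ, hM⟩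
    have hφ : φ ≠ 0 := by
      rintro rfl
      exact hdeg.1 (by simp [hM])
    by_cases hsub : lineOf φ ⊆ Uᶜ
    · left
      intro w hw
      obtain ⟨c, hc⟩ := huniq φ hφ hsub
      rw [hM, vecMulVec_mulVec_eq, hc, smul_dotProduct, hw, smul_zero, zero_smul]
    · right
      obtain ⟨p, hp, hpU⟩ := not_subset.1 hsub
      obtain ⟨x₁, hx₁, rfl⟩ := exists_pt p
      replace hp := (pt_mem_lineOf hx₁).1 hp
      replace hpU := not_not.1 hpU
      obtain ⟨w, hw⟩ := exists_dotProduct_ne_zero hφ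
      rw [dotProduct_comm] at hw
      -- a second point of the kernel of `M` inside the open set `U`
      obtain ⟨y, hφy, hy⟩ := exists_dotProduct_eq_zero_notMem_span (x := x₁) hφ
      have hcont : ContinuousAt (fun t : ℂ => pt (x₁ + t • y)) 0 :=
        ContinuousAt.comp (g := pt) (f := fun t : ℂ => x₁ + t • y)
          (by simpa using continuousAt_pt hx₁) (by fun_prop)
      have hev : ∀ᶠ t in 𝓝[≠] (0 : ℂ), pt (x₁ + t • y) ∈ U :=
        (hcont.eventually_mem (hUo.mem_nhds (by simpa using hpU))).filter_mono nhdsWithin_le_nhds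
      obtain ⟨t, ht, ht0⟩ := (hev.and self_mem_nhdsWithin).exists
      have hindep : ∀ a b : ℂ, b ≠ 0 → a • x₁ + b • y ≠ 0 := by
        intro a b hb h0
        refine hy (-(a / b)) ?_
        have h1 : b • y = -(a • x₁) := by rw [eq_neg_iff_add_eq_zero, add_comm, h0]
        have h2 : y = b⁻¹ • (b • y) := by rw [smul_smul, inv_mul_cancel₀ hb, one_smul]
        rw [h2, h1, smul_neg, smul_smul, neg_smul, div_eq_inv_mul]
      have hx₂ : x₁ + t • y ≠ 0 := by simpa using hindep 1 t ht0
      have hφ₂ : φ ⬝ᵥ (x₁ + t • y) = 0 := by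
        rw [dotProduct_add, dotProduct_smul, hp, hφy, smul_zero, add_zero]
      obtain ⟨hψ₁, hψ₁U⟩ := hU.lineOf_subset_compl hUo hγ hdeg hM hx₁ hpU hp hw
      obtain ⟨hψ₂, hψ₂U⟩ := hU.lineOf_subset_compl hUo hγ hdeg hM hx₂ ht hφ₂ hw
      obtain ⟨c₁, hc₁⟩ := huniq _ hψ₁ hψ₁U
      obtain ⟨c₂, hc₂⟩ := huniq _ hψ₂ hψ₂U
      have hc₁0 : c₁ ≠ 0 := by
        rintro rfl
        exact hψ₁ (by rw [hc₁, zero_smul])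
      -- both lines agree, so that a combination of the two points spans the image of `M'`
      have hx₃ : c₂ • x₁ - c₁ • (x₁ + t • y) ≠ 0 := by
        have := hindep (c₂ - c₁) (-(c₁ * t)) (neg_ne_zero.2 (mul_ne_zero hc₁0 ht0))
        convert this using 1
        module
      obtain ⟨φ', hM'⟩ := hdeg.eq_vecMulVec_of_vecMul_eq_zero (w := w) hM hx₃
        (by rw [dotProduct_sub, dotProduct_smul, dotProduct_smul, hp, hφ₂]; simp) hw (by
          rw [map_sub, map_smul, map_smul, LinearMap.sub_apply, LinearMap.smul_apply,
            LinearMap.smul_apply, sub_vecMul, smul_vecMul, smul_vecMul, hc₁, hc₂, smul_smul,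
            smul_smul, mul_comm, sub_self])
      intro z hz
      rw [hM', vecMulVec_mulVec_eq]
      have h1 : ((x₁ ⨯₃ w) ᵥ* M') ⬝ᵥ z = 0 := by rw [hc₁, smul_dotProduct, hz, smul_zero]
      rw [← dotProduct_mulVec, hM', vecMulVec_mulVec_eq, dotProduct_smul, smul_eq_zero] at h1
      rcases h1 with h1 | h1
      · rw [h1, zero_smul]
      · refine absurd ?_ hψ₁
        funext j
        have h2 : ((x₁ ⨯₃ w) ᵥ* M') ⬝ᵥ Pi.single j 1 = 0 := by
          rw [← dotProduct_mulVec, hM', vecMulVec_mulVec_eq, dotProduct_smul, h1, smul_zero]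
        simpa using h2
  rcases exists_vecMulVec_of_mul_eq_zero hdeg.mul_eq_zero hdeg.1 hdeg.2.1 with h | h
  · exact key γ M M' hγ hdeg h
  · exact (key _ M' M (fun n => Γ.inv_mem (hγ n)) hdeg.inv h).symm

theorem vecMul_ne_zero (A : SL(3, ℂ)) {φ : Fin 3 → ℂ} (hφ : φ ≠ 0) : φ ᵥ* A.1 ≠ 0 := by
  intro h
  apply hφ
  have h1 := congrArg (· ᵥ* (A⁻¹).1) h
  simpa only [vecMul_vecMul, val_mul_inv_val, vecMul_one, zero_vecMul] using h1

/-- If a group without fixed points leaves invariant a set which does not contain three lines in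
general position, then all lines in this set coincide: otherwise they would all pass through a
single point, which would be fixed. -/
theorem exists_smul_eq_of_lineOf_subset_of_not_containsTriangle {F : Set P2}
    (hinv : ∀ γ ∈ Γ, ∀ x ∈ F, γ • x ∈ F) (htri : ¬ ContainsTriangle F)
    (hfix : ¬ ∃ p : P2, ∀ γ ∈ Γ, γ • p = p) {χ ψ : Fin 3 → ℂ} (hχ : χ ≠ 0) (hχF : lineOf χ ⊆ F)
    (hψF : lineOf ψ ⊆ F) : ∃ c : ℂ, ψ = c • χ := by
  by_contra hc
  have hq : χ ⨯₃ ψ ≠ 0 := fun h => hc (exists_smul_eq_of_crossProduct_eq_zero hχ h)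
  have hconc : ∀ θ : Fin 3 → ℂ, lineOf θ ⊆ F → θ ⬝ᵥ (χ ⨯₃ ψ) = 0 := by
    intro θ hθ
    by_contra hdet
    rw [triple_product_eq_det] at hdet
    refine htri ⟨![θ, χ, ψ], fun v hv => ?_, fun i => by fin_cases i <;> assumption⟩
    exact eq_zero_of_mulVec_eq_zero hdet (funext hv)
  refine hfix ⟨pt (χ ⨯₃ ψ), fun γ hγ => ?_⟩
  obtain ⟨A, rfl⟩ := QuotientGroup.mk_surjective γ
  have h1 := hconc _ (lineOf_vecMul_subset_of_mem hinv hγ hχF)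
  have h2 := hconc _ (lineOf_vecMul_subset_of_mem hinv hγ hψF)
  rw [← dotProduct_mulVec] at h1 h2
  obtain ⟨c, hc⟩ := exists_smul_crossProduct_of_dotProduct_eq_zero hq h1 h2
  have hAq := mulVec_ne_zero A hq
  refine (smul_pt A hq).trans ((pt_eq_pt_iff hAq hq).2 ⟨c, hc.symm⟩)

end ProperAction

/-! ### Groups with an invariant line which captures all degenerations -/

section InvariantLine

open scoped Matrix.Norms.Elementwise

theorem norm_mulVec_le (X : Matrix (Fin 3) (Fin 3) ℂ) (w : Fin 3 → ℂ) :
    ‖X *ᵥ w‖ ≤ 3 * ‖X‖ * ‖w‖ := by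
  refine (pi_norm_le_iff_of_nonneg (by positivity)).2 fun i => ?_
  have h1 : ∀ j ∈ Finset.univ, ‖X i j * w j‖ ≤ ‖X‖ * ‖w‖ := fun j _ => by
    rw [norm_mul]
    exact mul_le_mul (norm_entry_le_entrywise_sup_norm X) (norm_le_pi_norm w j) (norm_nonneg _)
      (norm_nonneg _)
  refine (norm_sum_le_of_le _ h1).trans (le_of_eq ?_)
  simp [mul_assoc]

theorem Degenerates.mulVec_eq_zero_of_bounded {γ : ℕ → PSL(3, ℂ)}
    {M M' : Matrix (Fin 3) (Fin 3) ℂ} (hdeg : Degenerates γ M M') {B : ℕ → SL(3, ℂ)}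
    (hB : ∀ n, (B n : PSL(3, ℂ)) = γ n) {f : Fin 3 → ℂ} {C : ℝ} (hC : ∀ n, ‖(B n).1 *ᵥ f‖ ≤ C) :
    M *ᵥ f = 0 := by
  obtain ⟨-, -, A, a, b, hA, -, -, ha0, -, hlim, -⟩ := hdeg
  refine tendsto_nhds_unique (tendsto_mulVec hlim (tendsto_const_nhds (x := f))) ?_
  choose ω hω hAB using fun n => exists_smul_eq_of_mk_eq ((hB n).trans (hA n).symm)
  refine squeeze_zero_norm (a := fun n => ‖a n‖ * C) (fun n => ?_)
    (by simpa using ha0.norm.mul_const C)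
  rw [hAB n, smul_mulVec, smul_mulVec, norm_smul, norm_smul, hω, one_mul]
  exact mul_le_mul_of_nonneg_left (hC n) (norm_nonneg _)

theorem exists_subseq_tendsto_smul (X : ℕ → Matrix (Fin 3) (Fin 3) ℂ) (hX : ∀ n, X n ≠ 0) :
    ∃ φ : ℕ → ℕ, StrictMono φ ∧ ∃ d : ℕ → ℂ, (∀ n, d n ≠ 0) ∧ ∃ N, N ≠ 0 ∧
      Tendsto (fun n => d n • X (φ n)) atTop (𝓝 N) := by
  obtain ⟨φ, hφ, N, hN, hlim⟩ := exists_subseq_tendsto_normalized X hX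
  exact ⟨φ, hφ, fun n => (‖X (φ n)‖ : ℂ)⁻¹, fun n => by simpa using hX (φ n), N, hN, hlim⟩

variable {Γ : Subgroup PSL(3, ℂ)} {χ : Fin 3 → ℂ}

/-- The effect of `B ^ k * H * (B ^ k)⁻¹` on the attracting fixed point `f` of `B`. -/
theorem exists_conj_pow_mulVec {B H : SL(3, ℂ)} {l c : ℂ} {f : Fin 3 → ℂ} (hl : l ≠ 0)
    (hBχ : χ ᵥ* B.1 = l • χ) (hf : B.1 *ᵥ f = l • f)
    (hcontr : ∀ w, χ ⬝ᵥ w = 0 → ‖B.1 *ᵥ w‖ ≤ ‖l‖ / 2 * ‖w‖) (hHχ : χ ᵥ* H.1 = c • χ) :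
    ∃ e : ℕ → Fin 3 → ℂ, (∀ k, (B ^ k * H * (B ^ k)⁻¹).1 *ᵥ f = c • f + e k) ∧
      (∀ k, χ ⬝ᵥ e k = 0) ∧ (∀ k, ‖e (k + 1)‖ ≤ 1 / 2 * ‖e k‖) ∧ e 0 = H.1 *ᵥ f - c • f ∧
      ∀ k, e k = 0 → e 0 = 0 := by
  have hval : ∀ X Y : SL(3, ℂ), ∀ z : Fin 3 → ℂ, (X * Y).1 *ᵥ z = X.1 *ᵥ (Y.1 *ᵥ z) :=
    fun X Y z => (mulVec_mulVec z X.1 Y.1).symm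
  have hpow : ∀ k : ℕ, (B ^ k).1 *ᵥ f = l ^ k • f := by
    intro k
    induction k with
    | zero => simp
    | succ k ih => rw [pow_succ', hval, ih, mulVec_smul, hf, smul_smul, pow_succ]
  have hinv : ∀ k : ℕ, ((B ^ k)⁻¹).1 *ᵥ f = (l ^ k)⁻¹ • f := by
    intro k
    have h1 := inv_mulVec_mulVec (B ^ k) f
    rw [hpow, mulVec_smul] at h1
    rw [eq_inv_smul_iff₀ (pow_ne_zero k hl), h1]
  let e : ℕ → Fin 3 → ℂ := fun k => (l ^ k)⁻¹ • ((B ^ k).1 *ᵥ (H.1 *ᵥ f - c • f))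
  have hsucc : ∀ k, e (k + 1) = l⁻¹ • (B.1 *ᵥ e k) := by
    intro k
    change (l ^ (k + 1))⁻¹ • ((B ^ (k + 1)).1 *ᵥ (H.1 *ᵥ f - c • f)) =
      l⁻¹ • (B.1 *ᵥ ((l ^ k)⁻¹ • ((B ^ k).1 *ᵥ (H.1 *ᵥ f - c • f))))
    rw [pow_succ' B, hval, mulVec_smul, smul_smul, pow_succ' l, mul_inv]
  have h0 : e 0 = H.1 *ᵥ f - c • f := by simp [e]
  have hχe : ∀ k, χ ⬝ᵥ e k = 0 := by
    intro k
    induction k with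
    | zero =>
      rw [h0, dotProduct_sub, dotProduct_mulVec, hHχ, smul_dotProduct, dotProduct_smul, sub_self]
    | succ k ih =>
      rw [hsucc, dotProduct_smul, dotProduct_mulVec, hBχ, smul_dotProduct, ih, smul_zero, smul_zero]
  refine ⟨e, fun k => ?_, hχe, fun k => ?_, h0, fun k hk => ?_⟩
  · have h1 : H.1 *ᵥ f = c • f + (H.1 *ᵥ f - c • f) := by abel
    rw [hval, hval, hinv, mulVec_smul, mulVec_smul, h1, mulVec_add, mulVec_smul, hpow, smul_add,
      smul_comm c, smul_smul, inv_mul_cancel₀ (pow_ne_zero k hl), one_smul]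
  · rw [hsucc, norm_smul, norm_inv]
    have hl' : 0 < ‖l‖ := norm_pos_iff.2 hl
    calc ‖l‖⁻¹ * ‖B.1 *ᵥ e k‖ ≤ ‖l‖⁻¹ * (‖l‖ / 2 * ‖e k‖) :=
          mul_le_mul_of_nonneg_left (hcontr _ (hχe k)) (by positivity)
      _ = 1 / 2 * ‖e k‖ := by field_simp
  · have h1 : (B ^ k).1 *ᵥ (H.1 *ᵥ f - c • f) = 0 := by
      simpa [e, hl] using hk
    rw [h0, ← inv_mulVec_mulVec (B ^ k) (H.1 *ᵥ f - c • f), h1, mulVec_zero]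

/-- A group which acts on the complement of an invariant line by affine transformations, and in
which every degeneration has this line as one of its two kernels, fixes the fixed point of each of
its contractions. -/
theorem smul_eq_of_contraction (hΓ : DiscreteTopology Γ)
    (hχ : ∀ A : SL(3, ℂ), (A : PSL(3, ℂ)) ∈ Γ → ∃ c : ℂ, c ≠ 0 ∧ χ ᵥ* A.1 = c • χ)
    (hP : ∀ γ M M', (∀ n, γ n ∈ Γ) → Degenerates γ M M' →
      (∀ w, χ ⬝ᵥ w = 0 → M *ᵥ w = 0) ∨ ∀ w, χ ⬝ᵥ w = 0 → M' *ᵥ w = 0)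
    {B : SL(3, ℂ)} (hB : (B : PSL(3, ℂ)) ∈ Γ) {l : ℂ} (hl : l ≠ 0) {f : Fin 3 → ℂ}
    (hBχ : χ ᵥ* B.1 = l • χ) (hf : B.1 *ᵥ f = l • f) (hχf : χ ⬝ᵥ f ≠ 0)
    (hcontr : ∀ w, χ ⬝ᵥ w = 0 → ‖B.1 *ᵥ w‖ ≤ ‖l‖ / 2 * ‖w‖) :
    ∀ γ ∈ Γ, γ • pt f = pt f := by
  have hf0 : f ≠ 0 := by
    rintro rfl
    simp at hχf
  intro h hh
  by_contra hmove
  obtain ⟨H, rfl⟩ := QuotientGroup.mk_surjective h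
  obtain ⟨c, hc, hHχ⟩ := hχ H hh
  -- conjugating by powers of `B` yields a sequence in `Γ` which is bounded at `f`
  let K : SL(3, ℂ) → ℕ → SL(3, ℂ) := fun H k => B ^ k * H * (B ^ k)⁻¹
  have hbound : ∀ H : SL(3, ℂ), (H : PSL(3, ℂ)) ∈ Γ → ∃ C : ℝ, ∀ k, ‖(K H k).1 *ᵥ f‖ ≤ C := by
    intro H hH
    obtain ⟨c, -, hHχ⟩ := hχ H hH
    obtain ⟨e, he, -, hdecay, -, -⟩ := exists_conj_pow_mulVec hl hBχ hf hcontr hHχ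
    have hanti : Antitone fun k => ‖e k‖ := antitone_nat_of_succ_le fun k =>
      (hdecay k).trans (by linarith [norm_nonneg (e k)])
    refine ⟨‖c • f‖ + ‖e 0‖, fun k => ?_⟩
    rw [he k]
    exact (norm_add_le _ _).trans (add_le_add_right (hanti (Nat.zero_le k)) _)
  have hKΓ : ∀ k, (K H k : PSL(3, ℂ)) ∈ Γ := fun k =>
    Γ.mul_mem (Γ.mul_mem (Γ.pow_mem hB k) hh) (Γ.inv_mem (Γ.pow_mem hB k))
  have hKinv : ∀ k, (K H k)⁻¹ = K H⁻¹ k := fun k => by simp only [K, conj_inv]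
  have hinj : Function.Injective fun k => (K H k : PSL(3, ℂ)) := by
    obtain ⟨e, he, hχe, hdecay, he0, hek⟩ := exists_conj_pow_mulVec hl hBχ hf hcontr hHχ
    have hne : ∀ k, e k ≠ 0 := by
      intro k hk
      have h0 := hek k hk
      rw [he0, sub_eq_zero] at h0
      exact hmove ((smul_pt H hf0).trans (by rw [h0, pt_smul hc hf0]))
    have hstrict : StrictAnti fun k => ‖e k‖ := strictAnti_nat_of_succ_lt fun k =>
      (hdecay k).trans_lt (by linarith [norm_pos_iff.2 (hne k)])
    intro i j hij
    obtain ⟨ω, -, hω⟩ := exists_smul_eq_of_mk_eq hij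
    have h1 : c • f + e j = ω • (c • f + e i) := by
      rw [← he i, ← he j, ← smul_mulVec]
      exact congrArg (· *ᵥ f) hω
    have h2 := congrArg (χ ⬝ᵥ ·) h1
    simp only [dotProduct_add, dotProduct_smul, hχe, add_zero, smul_eq_mul] at h2
    have hω1 : ω = 1 := mul_right_cancel₀ (mul_ne_zero hc hχf) (by rw [one_mul]; exact h2.symm)
    rw [hω1, one_smul, add_right_inj] at h1
    exact hstrict.injective (congrArg norm h1.symm)
  obtain ⟨φ, hφ, M, M', hdeg⟩ := exists_subseq_degenerates hΓ hKΓ hinj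
  obtain ⟨C, hC⟩ := hbound H hh
  obtain ⟨C', hC'⟩ := hbound H⁻¹ (Γ.inv_mem hh)
  have hMf : M *ᵥ f = 0 := hdeg.mulVec_eq_zero_of_bounded (fun n => rfl) fun n => hC (φ n)
  have hM'f : M' *ᵥ f = 0 := hdeg.inv.mulVec_eq_zero_of_bounded (B := fun n => K H⁻¹ (φ n))
    (fun n => by rw [← hKinv]; rfl) fun n => hC' (φ n)
  rcases hP _ M M' (fun n => hKΓ (φ n)) hdeg with h1 | h1
  · exact hdeg.1 (eq_zero_of_forall_mulVec hχf hMf h1)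
  · exact hdeg.2.1 (eq_zero_of_forall_mulVec hχf hM'f h1)

/-- If the inverses degenerate to the projection onto a point off the invariant line, they are
eventually contractions, so that the group has a fixed point. -/
theorem exists_fixedPoint_of_dotProduct_ne_zero (hΓ : DiscreteTopology Γ)
    (hχ : ∀ A : SL(3, ℂ), (A : PSL(3, ℂ)) ∈ Γ → ∃ c : ℂ, c ≠ 0 ∧ χ ᵥ* A.1 = c • χ)
    (hP : ∀ γ M M', (∀ n, γ n ∈ Γ) → Degenerates γ M M' →
      (∀ w, χ ⬝ᵥ w = 0 → M *ᵥ w = 0) ∨ ∀ w, χ ⬝ᵥ w = 0 → M' *ᵥ w = 0)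
    {γ : ℕ → PSL(3, ℂ)} (hγ : ∀ n, γ n ∈ Γ) {M : Matrix (Fin 3) (Fin 3) ℂ} {v : Fin 3 → ℂ}
    (hdeg : Degenerates γ M (vecMulVec v χ)) (hv : χ ⬝ᵥ v ≠ 0) :
    ∃ p : P2, ∀ γ ∈ Γ, γ • p = p := by
  obtain ⟨-, -, A, a, b, hA, ha, hb, -, -, -, hlim⟩ := hdeg
  have hAΓ : ∀ n, (((A n)⁻¹ : SL(3, ℂ)) : PSL(3, ℂ)) ∈ Γ := fun n => by
    rw [QuotientGroup.mk_inv, hA]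
    exact Γ.inv_mem (hγ n)
  choose l hl hlχ using fun n => hχ _ (hAΓ n)
  have hscal : Tendsto (fun n => b n * l n) atTop (𝓝 (χ ⬝ᵥ v)) := by
    have h1 := (tendsto_dotProduct (tendsto_vecMul hlim χ)
      (tendsto_const_nhds (x := v))).div_const (χ ⬝ᵥ v)
    rw [← dotProduct_mulVec, vecMulVec_mulVec_eq, dotProduct_smul, smul_eq_mul,
      mul_div_cancel_right₀ _ hv] at h1
    refine h1.congr fun n => ?_
    rw [vecMul_smul, hlχ, smul_smul, smul_dotProduct, smul_eq_mul, mul_div_cancel_right₀ _ hv]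
  have hdiff : Tendsto (fun n => 6 * ‖b n • ((A n)⁻¹).1 - vecMulVec v χ‖) atTop (𝓝 0) := by
    have h1 := (tendsto_iff_norm_sub_tendsto_zero.1 hlim).const_mul 6
    rwa [mul_zero] at h1
  obtain ⟨n, hn⟩ := (hdiff.eventually_lt hscal.norm (norm_pos_iff.2 hv)).exists
  have hcontr : ∀ w, χ ⬝ᵥ w = 0 → ‖((A n)⁻¹).1 *ᵥ w‖ ≤ ‖l n‖ / 2 * ‖w‖ := by
    intro w hw
    have h1 := norm_mulVec_le (b n • ((A n)⁻¹).1 - vecMulVec v χ) w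
    rw [sub_mulVec, vecMulVec_mulVec_eq, hw, zero_smul, sub_zero, smul_mulVec, norm_smul] at h1
    rw [norm_mul] at hn
    have hb0 : 0 < ‖b n‖ := norm_pos_iff.2 (hb n)
    refine le_of_mul_le_mul_left ?_ hb0
    nlinarith [norm_nonneg w]
  -- the covector `χ` shows that `l n` is an eigenvalue
  obtain ⟨f, hf0, hf⟩ : ∃ f : Fin 3 → ℂ, f ≠ 0 ∧ ((A n)⁻¹).1 *ᵥ f = l n • f := by
    have hdet : (((A n)⁻¹).1 - l n • (1 : Matrix (Fin 3) (Fin 3) ℂ)).det = 0 := by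
      refine exists_vecMul_eq_zero_iff.1 ⟨χ, ?_, ?_⟩
      · rintro rfl
        simp at hv
      · rw [vecMul_sub, hlχ, vecMul_smul, vecMul_one, sub_self]
    obtain ⟨f, hf0, hf⟩ := exists_mulVec_eq_zero_iff.2 hdet
    refine ⟨f, hf0, ?_⟩
    rwa [sub_mulVec, smul_mulVec, one_mulVec, sub_eq_zero] at hf
  refine ⟨pt f, smul_eq_of_contraction hΓ hχ hP (hAΓ n) (hl n) (hlχ n) hf (fun h0 => ?_) hcontr⟩
  have h1 := hcontr f h0
  rw [hf, norm_smul] at h1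
  have : 0 < ‖l n‖ * ‖f‖ := mul_pos (norm_pos_iff.2 (hl n)) (norm_pos_iff.2 hf0)
  linarith

end InvariantLine

/-- If the inverses degenerate to a point of the invariant line, and `M` kills a point `p` off this
line, then `M` maps the line to a single point, and every element `h` of the group fixes it:
otherwise neither limit of the conjugates `(γ n)⁻¹ * h * γ n` would vanish on the line. -/
theorem exists_fixedPoint_of_dotProduct_eq_zero {Γ : Subgroup PSL(3, ℂ)} {χ : Fin 3 → ℂ}
    (hχ : ∀ A : SL(3, ℂ), (A : PSL(3, ℂ)) ∈ Γ → ∃ c : ℂ, c ≠ 0 ∧ χ ᵥ* A.1 = c • χ)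
    (hP : ∀ γ M M', (∀ n, γ n ∈ Γ) → Degenerates γ M M' →
      (∀ w, χ ⬝ᵥ w = 0 → M *ᵥ w = 0) ∨ ∀ w, χ ⬝ᵥ w = 0 → M' *ᵥ w = 0)
    {γ : ℕ → PSL(3, ℂ)} (hγ : ∀ n, γ n ∈ Γ) {M : Matrix (Fin 3) (Fin 3) ℂ} {v p : Fin 3 → ℂ}
    (hdeg : Degenerates γ M (vecMulVec v χ)) (hv : χ ⬝ᵥ v = 0) (hp : χ ⬝ᵥ p = 1)
    (hMp : M *ᵥ p = 0) : ∃ q : P2, ∀ γ ∈ Γ, γ • q = q := by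
  have hv0 : v ≠ 0 := by
    rintro rfl
    exact hdeg.2.1 (by simp)
  have hχ0 : χ ≠ 0 := by
    rintro rfl
    simp at hp
  -- the image of `M` lies on the invariant line, and `v` in its kernel
  have hχM : ∀ z, χ ⬝ᵥ (M *ᵥ z) = 0 := by
    intro z
    have h1 := congrArg (· *ᵥ z) hdeg.mul_eq_zero'
    simp only [← mulVec_mulVec, vecMulVec_mulVec_eq, zero_mulVec, smul_eq_zero] at h1
    exact h1.resolve_right hv0
  have hMv : M *ᵥ v = 0 := by
    have h1 := congrArg (· *ᵥ p) hdeg.mul_eq_zero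
    simpa only [← mulVec_mulVec, vecMulVec_mulVec_eq, hp, one_smul, zero_mulVec] using h1
  obtain ⟨w₀, hw₀, hMw₀⟩ : ∃ w, χ ⬝ᵥ w = 0 ∧ M *ᵥ w ≠ 0 := by
    by_contra hc
    push Not at hc
    exact hdeg.1 (eq_zero_of_forall_mulVec (by rw [hp]; exact one_ne_zero) hMp hc)
  obtain ⟨-, -, A, a, b, hA, ha, -, -, -, hlim, -⟩ := hdeg
  have hAΓ : ∀ n, (A n : PSL(3, ℂ)) ∈ Γ := fun n => by
    rw [hA]
    exact hγ n
  -- `P` projects onto the kernel of `χ`; the restrictions of the inverses to it are rescaled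
  set P : Matrix (Fin 3) (Fin 3) ℂ := 1 - vecMulVec p χ with hPdef
  have hPw : ∀ z, P *ᵥ z = z - (χ ⬝ᵥ z) • p := fun z => by
    rw [hPdef, sub_mulVec, one_mulVec, vecMulVec_mulVec_eq]
  have hPw0 : ∀ z, χ ⬝ᵥ z = 0 → P *ᵥ z = z := fun z hz => by rw [hPw, hz, zero_smul, sub_zero]
  have hne : ∀ n, ((A n)⁻¹).1 * P ≠ 0 := by
    intro n h0
    have h1 : ((A n)⁻¹).1 *ᵥ v = 0 := by
      rw [← hPw0 v hv, mulVec_mulVec, h0, zero_mulVec]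
    exact mulVec_ne_zero _ hv0 h1
  obtain ⟨φ, hφ, d, hd0, N, hN, hNlim⟩ := exists_subseq_tendsto_smul _ hne
  have hMlim := hlim.comp hφ.tendsto_atTop
  have hNp : N *ᵥ p = 0 := by
    refine tendsto_nhds_unique (tendsto_mulVec hNlim (tendsto_const_nhds (x := p))) ?_
    refine tendsto_const_nhds.congr fun n => ?_
    rw [smul_mulVec, ← mulVec_mulVec, hPw, hp, one_smul, sub_self, mulVec_zero, smul_zero]
  -- on the invariant line the product of the two rescaled factors is a scalar
  have hNM : ∀ w, χ ⬝ᵥ w = 0 →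
      Tendsto (fun n => (d n * a (φ n)) • w) atTop (𝓝 (N *ᵥ (M *ᵥ w))) := by
    intro w hw
    refine (tendsto_mulVec hNlim (tendsto_mulVec hMlim (tendsto_const_nhds (x := w)))).congr
      fun n => ?_
    obtain ⟨c, -, hc⟩ := hχ _ (hAΓ (φ n))
    simp only [Function.comp]
    rw [smul_mulVec, smul_mulVec, mulVec_smul, ← mulVec_mulVec, hPw0, inv_mulVec_mulVec, smul_smul]
    rw [dotProduct_mulVec, hc, smul_dotProduct, hw, smul_zero]
  have hs0 : Tendsto (fun n => d n * a (φ n)) atTop (𝓝 0) := by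
    have h1 := hNM v hv
    rw [hMv, mulVec_zero] at h1
    obtain ⟨θ, hθ⟩ := exists_dotProduct_ne_zero hv0
    have h2 := (tendsto_dotProduct (tendsto_const_nhds (x := θ)) h1).div_const (θ ⬝ᵥ v)
    simpa [dotProduct_smul, mul_div_cancel_right₀ _ hθ] using h2
  have hNf : N *ᵥ (M *ᵥ w₀) = 0 := by
    refine tendsto_nhds_unique (hNM w₀ hw₀) ?_
    simpa using hs0.smul_const w₀
  refine ⟨pt (M *ᵥ w₀), fun h hh => ?_⟩
  by_contra hmove
  obtain ⟨H, rfl⟩ := QuotientGroup.mk_surjective h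
  set f := M *ᵥ w₀ with hfdef
  -- `N` only annihilates `f` on the invariant line
  have hNH : ∀ H : SL(3, ℂ), (H : PSL(3, ℂ)) ∈ Γ → (H : PSL(3, ℂ)) • pt f ≠ pt f →
      N *ᵥ (H.1 *ᵥ f) ≠ 0 := by
    intro H hH hmove hzero
    obtain ⟨c, -, hc⟩ := hχ H hH
    have hχHf : χ ⬝ᵥ (H.1 *ᵥ f) = 0 := by
      rw [dotProduct_mulVec, hc, smul_dotProduct, hχM, smul_zero]
    have hcross : f ⨯₃ (H.1 *ᵥ f) ≠ 0 := by
      intro h0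
      obtain ⟨c, hc⟩ := exists_smul_eq_of_crossProduct_eq_zero hMw₀ h0
      exact hmove ((smul_pt H hMw₀).trans ((pt_eq_pt_iff (mulVec_ne_zero _ hMw₀) hMw₀).2
        ⟨c, hc.symm⟩))
    obtain ⟨y, hy⟩ := exists_smul_crossProduct_of_dotProduct_eq_zero (v := χ) hcross
      (by rw [dotProduct_comm]; exact hχM w₀) (by rw [dotProduct_comm]; exact hχHf)
    have hy0 : y ≠ 0 := by
      rintro rfl
      exact hχ0 (by rw [hy, zero_smul])
    refine hN (eq_zero_of_forall_mulVec (by rw [hp]; exact one_ne_zero) hNp fun z hz => ?_)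
    rw [hy, smul_dotProduct, smul_eq_zero] at hz
    obtain ⟨α, β, rfl⟩ := exists_eq_add_of_crossProduct_dotProduct_eq_zero hcross
      (hz.resolve_left hy0)
    rw [mulVec_add, mulVec_smul, mulVec_smul, hNf, hzero, smul_zero, smul_zero, add_zero]
  -- the limit of the rescaled conjugates of `H`
  have hlimconj : ∀ H : SL(3, ℂ), (H : PSL(3, ℂ)) ∈ Γ → ∃ E : Matrix (Fin 3) (Fin 3) ℂ,
      E *ᵥ w₀ = N *ᵥ (H.1 *ᵥ f) ∧ Tendsto (fun n => (d n * a (φ n)) •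
        ((A (φ n))⁻¹ * H * A (φ n)).1) atTop (𝓝 E) := by
    intro H hH
    obtain ⟨c, -, hc⟩ := hχ H hH
    refine ⟨N * (H.1 - c • (1 : Matrix (Fin 3) (Fin 3) ℂ)) * M, ?_, ?_⟩
    · rw [← mulVec_mulVec, ← mulVec_mulVec, ← hfdef, sub_mulVec, smul_mulVec, one_mulVec,
        mulVec_sub, mulVec_smul, hNf, smul_zero, sub_zero]
    · have h1 := ((hNlim.mul (tendsto_const_nhds
        (x := H.1 - c • (1 : Matrix (Fin 3) (Fin 3) ℂ)))).mul hMlim).add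
        ((hs0.mul_const c).smul_const (1 : Matrix (Fin 3) (Fin 3) ℂ))
      rw [zero_mul, zero_smul, add_zero] at h1
      refine h1.congr fun n => ?_
      have hPH : P * (H.1 - c • (1 : Matrix (Fin 3) (Fin 3) ℂ)) =
          H.1 - c • (1 : Matrix (Fin 3) (Fin 3) ℂ) := by
        refine Matrix.ext_of_mulVec_single fun i => ?_
        rw [← mulVec_mulVec, hPw0]
        rw [dotProduct_mulVec, vecMul_sub, hc, vecMul_smul, vecMul_one, sub_self, zero_dotProduct]
      have hval : ((A (φ n))⁻¹ * H * A (φ n)).1 = ((A (φ n))⁻¹).1 * H.1 * (A (φ n)).1 := rfl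
      simp only [Function.comp]
      rw [hval, smul_mul_assoc, smul_mul_smul_comm, mul_assoc ((A (φ n))⁻¹).1 P, hPH, mul_sub,
        sub_mul, mul_smul_comm, mul_one, smul_mul_assoc, inv_val_mul_val, smul_sub, smul_smul]
      abel
  have hsne : ∀ n, d n * a (φ n) ≠ 0 := fun n => mul_ne_zero (hd0 n) (ha (φ n))
  obtain ⟨E, hE, hElim⟩ := hlimconj H hh
  obtain ⟨E', hE', hElim'⟩ := hlimconj H⁻¹ (Γ.inv_mem hh)
  have hmove' : ((H⁻¹ : SL(3, ℂ)) : PSL(3, ℂ)) • pt f ≠ pt f := by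
    intro h0
    rw [QuotientGroup.mk_inv, inv_smul_eq_iff] at h0
    exact hmove h0.symm
  have hEw : E *ᵥ w₀ ≠ 0 := by
    rw [hE]
    exact hNH H hh hmove
  have hEw' : E' *ᵥ w₀ ≠ 0 := by
    rw [hE']
    exact hNH H⁻¹ (Γ.inv_mem hh) hmove'
  have hconj : Degenerates
      (fun n => (((A (φ n))⁻¹ * H * A (φ n) : SL(3, ℂ)) : PSL(3, ℂ))) E E' := by
    refine ⟨?_, ?_, fun n => (A (φ n))⁻¹ * H * A (φ n), fun n => d n * a (φ n),
      fun n => d n * a (φ n), fun n => rfl, hsne, hsne, hs0, hs0, hElim, ?_⟩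
    · rintro rfl
      simp at hEw
    · rintro rfl
      simp at hEw'
    · refine hElim'.congr fun n => ?_
      have hconj : (A (φ n))⁻¹ * H⁻¹ * A (φ n) = ((A (φ n))⁻¹ * H * A (φ n))⁻¹ := by group
      rw [hconj]
  have hmem : ∀ n, (((A (φ n))⁻¹ * H * A (φ n) : SL(3, ℂ)) : PSL(3, ℂ)) ∈ Γ := fun n =>
    Γ.mul_mem (Γ.mul_mem (Γ.inv_mem (hAΓ _)) hh) (hAΓ _)
  rcases hP _ E E' hmem hconj with h1 | h1
  · exact hEw (h1 w₀ hw₀)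
  · exact hEw' (h1 w₀ hw₀)

/-! ### Maximality of the discontinuity region -/

/-- If the complement of the equicontinuity set contains three lines in general position and the
group fixes no point, then so does the complement of every nonempty region of proper
discontinuity. -/
theorem ActsProperlyDiscontinuouslyOn.containsTriangle_compl {Γ : Subgroup PSL(3, ℂ)}
    (hΓ : DiscreteTopology Γ) (hfix : ¬ ∃ p : P2, ∀ γ ∈ Γ, γ • p = p)
    (htri : ContainsTriangle (equicontinuitySet (Γ : Set PSL(3, ℂ)))ᶜ) {U : Set P2}
    (hU : ActsProperlyDiscontinuouslyOn Γ U) (hUo : IsOpen U) : ContainsTriangle Uᶜ := by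
  by_contra hc
  have hinv : ∀ γ ∈ Γ, ∀ x ∈ Uᶜ, γ • x ∈ Uᶜ := fun γ hγ x hx h =>
    hx (by simpa using hU.1 _ (Γ.inv_mem hγ) _ h)
  -- off a given line there are kernels of degenerations
  have hker : ∀ χ : Fin 3 → ℂ, χ ≠ 0 → ∃ γ M M', (∀ n, γ n ∈ Γ) ∧ Degenerates γ M M' ∧
      ∃ v : Fin 3 → ℂ, M *ᵥ v = 0 ∧ χ ⬝ᵥ v ≠ 0 := by
    intro χ hχ
    by_contra hno
    push Not at hno
    refine htri.not_subset_lineOf hχ (compl_subset_comm.1 fun z hz => ⟨_,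
      (isClosed_lineOf χ).isOpen_compl, hz, isNormalFamilyOn_of_forall_mulVec_ne_zero hΓ
      fun γ M M' hγ hdeg v hv hvχ hMv => hvχ ((pt_mem_lineOf hv).2 (hno γ M M' hγ hdeg v hMv))⟩)
  obtain ⟨γ, M, M', hγ, hdeg, -⟩ := hker (Pi.single 0 1) (by simp)
  obtain ⟨χ, hχ, hχU⟩ := hU.exists_lineOf_subset_compl hUo hγ hdeg
  have huniq : ∀ ψ : Fin 3 → ℂ, ψ ≠ 0 → lineOf ψ ⊆ Uᶜ → ∃ c : ℂ, ψ = c • χ := fun ψ _ hψ =>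
    exists_smul_eq_of_lineOf_subset_of_not_containsTriangle hinv hc hfix hχ hχU hψ
  have hχinv : ∀ A : SL(3, ℂ), (A : PSL(3, ℂ)) ∈ Γ → ∃ c : ℂ, c ≠ 0 ∧ χ ᵥ* A.1 = c • χ := by
    intro A hA
    obtain ⟨c, hc⟩ := huniq _ (vecMul_ne_zero A hχ) (lineOf_vecMul_subset_of_mem hinv hA hχU)
    refine ⟨c, ?_, hc⟩
    rintro rfl
    exact vecMul_ne_zero A hχ (by rw [hc, zero_smul])
  have hP : ∀ γ M M', (∀ n, γ n ∈ Γ) → Degenerates γ M M' →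
      (∀ w, χ ⬝ᵥ w = 0 → M *ᵥ w = 0) ∨ ∀ w, χ ⬝ᵥ w = 0 → M' *ᵥ w = 0 :=
    fun γ M M' hγ hdeg => hU.mulVec_eq_zero_or hUo huniq hγ hdeg
  obtain ⟨γ, M, M', hγ, hdeg, p, hMp, hp⟩ := hker χ hχ
  -- rescale `p`, and write `M'` as a rank one matrix
  have hp1 : χ ⬝ᵥ ((χ ⬝ᵥ p)⁻¹ • p) = 1 := by
    rw [dotProduct_smul, smul_eq_mul, inv_mul_cancel₀ hp]
  have hMp1 : M *ᵥ ((χ ⬝ᵥ p)⁻¹ • p) = 0 := by rw [mulVec_smul, hMp, smul_zero]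
  have hM' : ∀ w, χ ⬝ᵥ w = 0 → M' *ᵥ w = 0 := (hP γ M M' hγ hdeg).resolve_left fun h =>
    hdeg.1 (eq_zero_of_forall_mulVec hp hMp h)
  have hM'eq : M' = vecMulVec (M' *ᵥ ((χ ⬝ᵥ p)⁻¹ • p)) χ := by
    rw [← sub_eq_zero]
    refine eq_zero_of_forall_mulVec (by rw [hp1]; exact one_ne_zero) ?_ fun w hw => ?_
    · rw [sub_mulVec, vecMulVec_mulVec_eq, hp1, one_smul, sub_self]
    · rw [sub_mulVec, vecMulVec_mulVec_eq, hw, hM' w hw, zero_smul, sub_zero]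
  rw [hM'eq] at hdeg
  by_cases hv : χ ⬝ᵥ (M' *ᵥ ((χ ⬝ᵥ p)⁻¹ • p)) = 0
  · exact hfix (exists_fixedPoint_of_dotProduct_eq_zero hχinv hP hγ hdeg hv hp1 hMp1)
  · exact hfix (exists_fixedPoint_of_dotProduct_ne_zero hΓ hχinv hP hγ hdeg hv)

end KulkarniPlane

theorem theorem2 (Γ : Subgroup PSL(3, ℂ)) (hdiscrete : DiscreteTopology Γ)
    (hlim : KulkarniPlane.ContainsThreeLinesInGeneralPosition (KulkarniPlane.limitSet Γ))
    (hcyc : KulkarniPlane.ContainsThreeLinesInGeneralPosition (KulkarniPlane.cyclicLimitSet Γ)) :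
    KulkarniPlane.limitSet Γ = KulkarniPlane.cyclicLimitSet Γ ∧
    KulkarniPlane.IsUnionOfComplexLines (KulkarniPlane.limitSet Γ) ∧
    KulkarniPlane.discontinuityRegion Γ =
      KulkarniPlane.equicontinuitySet (Γ : Set PSL(3, ℂ)) ∧
    ((¬ ∃ p : KulkarniPlane.P2, ∀ γ ∈ Γ, γ • p = p) →
      IsGreatest {U : Set KulkarniPlane.P2 |
          IsOpen U ∧ KulkarniPlane.ActsProperlyDiscontinuouslyOn Γ U}
        (KulkarniPlane.discontinuityRegion Γ)) := by
  have hΩ := KulkarniPlane.discontinuityRegion_eq_equicontinuitySet hdiscrete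
    hlim.containsTriangle
  have hΛ : KulkarniPlane.limitSet Γ =
      (KulkarniPlane.equicontinuitySet (Γ : Set PSL(3, ℂ)))ᶜ := by
    rw [← hΩ, KulkarniPlane.discontinuityRegion, compl_compl]
  have htri := hlim.containsTriangle
  rw [hΛ] at htri
  refine ⟨?_, ?_, hΩ, fun hfix => ⟨?_, ?_⟩⟩
  · rw [hΛ, KulkarniPlane.cyclicLimitSet_eq_compl_equicontinuitySet hdiscrete
      hcyc.containsTriangle]
  · rw [hΛ]
    exact KulkarniPlane.isUnionOfComplexLines_compl_equicontinuitySet hdiscrete htri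
  · rw [hΩ]
    exact ⟨KulkarniPlane.isOpen_equicontinuitySet _,
      KulkarniPlane.actsProperlyDiscontinuouslyOn_equicontinuitySet hdiscrete⟩
  · rintro U ⟨hUo, hU⟩
    rw [hΩ, ← compl_compl U]
    exact KulkarniPlane.compl_subset_equicontinuitySet hdiscrete
      (hU.containsTriangle_compl hdiscrete hfix htri hUo) hUo.isClosed_compl
      fun γ hγ x hx h => hx (by simpa using hU.1 _ (Γ.inv_mem hγ) _ h)
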